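/- Let $K$ be a (commutative) field with a non-trivial involutive automorphism $\sigma$ and fixed field $F$, let $V$ be a $K$-vector space of arbitrary (possibly infinite) dimension, and let $f:V\times V\to K$ be a non-degenerate $\sigma$-Hermitian form (additive in both arguments, $f(va,wb)=a^\sigma f(v,w)b$, $f(w,v)=f(v,w)^\sigma$). Suppose that the maximal vector dimension of a subspace on which $f$ vanishes identically is a finite number $r\ge 1$, so that $f$ defines a Hermitian polar space $\Delta$ of rank $r$: its points are the $1$-spaces $\langle v\rangle$ with $f(v,v)=0$, and its singular subspaces correspond to the subspaces of $V$ on which $f$ vanishes identically. Write $V$ as an orthogonal direct sum of hyperbolic planes and a subspace $V_0$ on which $f$ is anisotropic ($f(v,v)\neq0$ for $0\ne v\in V_0$); $V_0$, which is unique up to isometry, is called the anisotropic part. Two singular subspaces $U,W$ are opposite if they have the same dimension and no point of $U$ is collinear (that is, orthogonal) to all points of $W$; the perspectivity from $U$ to an opposite $W$ maps each subspace $S$ of $U$ to $S^\perp\cap W$. For a maximal singular subspace $U$, let $\Pi(U)$ be the group of all compositions of perspectivities $U=U_0\to U_1\to\cdots\to U_n=U$ (acting on the set of subspaces of $U$),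 and $\Pi^+(U)$ the subgroup of those compositions for which $n$ can be taken even. Let $\mathsf{SL}_r(K;F)$ be the group of $r\times r$ matrices over $K$ with determinant in $F^\times$, and $\mathsf{PSL}_r(K;F)$ its quotient by its centre. A polarity of $U$ with companion involution $\sigma$ is a map $S\mapsto S^{\perp_B}$ on the subspaces of $U$, where $B$ is a non-degenerate reflexive form on $U$ which is $\sigma$-semilinear in one argument and linear in the other. Let $U$ be a maximal singular subspace of $\Delta$. Then $U$, as a vector space, is isomorphic to $K^r$, it has polarities with companion involution $\sigma$, and the following hold with respect to every linear identification of $U$ with $K^r$. (i) If the anisotropic part is trivial, then $\Pi^+(U)\cong\mathsf{PSL}_r(K;F)$ in its standard permutation representation on the projective space of $U$; moreover, for every polarity $\rho$ of $U$ with companion involution $\sigma$, $\Pi(U)\cong\mathsf{PSL}_r(K;F)\rtimes\langle\rho\rangle$, where $\mathsf{PSL}_r(K;F)$ acts on $U$ in the standard way and $\rho$ acts as itself. (ii) If the anisotropic part is non-trivial, then $\Pi^+(U)\cong\mathsf{PGL}_r(K)$ in its standard permutation representation on the projective space of $U$; moreover, for every polarity $\rho$ of $U$ with companion involution $\sigma$,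 $\Pi(U)\cong\mathsf{PGL}_r(K)\rtimes\langle\rho\rangle$, where $\mathsf{PGL}_r(K)$ acts on $U$ in the standard way and $\rho$ acts as itself. -/

import Mathlib

namespace HermitianPolar

open Module

variable {K V : Type*} [Field K] [AddCommGroup V] [Module K V] {σ : K →+* K}

/-! ### Hermitian polar spaces -/

/-- A subspace of `V` is (the vector space of) a singular subspace if any two of its vectors are
orthogonal. In particular every vector `v` in it satisfies `f v v = 0`. -/
def IsSingular (f : V →ₛₗ[σ] V →ₗ[K] K) (U : Submodule K V) : Prop :=
  ∀ u ∈ U, ∀ v ∈ U, f u v = 0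

/-- The form `f` on `V` (of arbitrary dimension) defines a Hermitian polar space of (finite)
rank `r`: `σ` is a non-trivial involution of `K`, the form is `σ`-Hermitian and non-degenerate,
and the maximum of the vector dimensions of singular subspaces is `r`. -/
structure IsHermitianPolarSpace (f : V →ₛₗ[σ] V →ₗ[K] K) (r : ℕ) : Prop where
  involutive : ∀ a : K, σ (σ a) = a
  nontrivial : σ ≠ RingHom.id K
  hermitian : f.IsSymm
  nondegenerate : f.Nondegenerate
  exists_rank : ∃ U : Submodule K V, IsSingular f U ∧ Module.rank K U = r
  rank_le : ∀ U : Submodule K V, IsSingular f U → Module.rank K U ≤ r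

/-- `V₀` is an anisotropic part of `f`: for some hyperbolic basis
`e 1, …, e n, e' 1, …, e' n` of a complement of `V₀`, orthogonal to `V₀`, the form is
`∑ (σ (x i) * y' i + σ (x' i) * y i) + f₀`, with `f₀` anisotropic on `V₀`. -/
def IsAnisotropicPart (f : V →ₛₗ[σ] V →ₗ[K] K) (V₀ : Submodule K V) : Prop :=
  ∃ (n : ℕ) (e e' : Fin n → V),
    (∀ i j, f (e i) (e j) = 0) ∧ (∀ i j, f (e' i) (e' j) = 0) ∧
    (∀ i j, f (e i) (e' j) = if i = j then 1 else 0) ∧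
    V₀ ≤ (Submodule.span K (Set.range e ∪ Set.range e')).orthogonalBilin f ∧
    IsCompl (Submodule.span K (Set.range e ∪ Set.range e')) V₀ ∧
    ∀ v ∈ V₀, f v v = 0 → v = 0

/-- The anisotropic part is trivial: `V` itself has a hyperbolic basis. -/
def HasTrivialAnisotropicPart (f : V →ₛₗ[σ] V →ₗ[K] K) : Prop :=
  IsAnisotropicPart f ⊥

/-! ### Opposition, perspectivities and projectivities -/

/-- Opposite singular subspaces: they have the same (finite) dimension, and no point of `U` is
collinear to all points of `W`. -/
structure Opposite (f : V →ₛₗ[σ] V →ₗ[K] K) (U W : Submodule K V) : Prop where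
  left : IsSingular f U
  right : IsSingular f W
  finite_left : FiniteDimensional K U
  finite_right : FiniteDimensional K W
  finrank_eq : finrank K U = finrank K W
  disjoint : U ⊓ W.orthogonalBilin f = ⊥

/-- The perspectivity from `U` to `W`, which maps a subspace `S` of `U` to `S^⊥ ∩ W`. -/
def perspectivity (f : V →ₛₗ[σ] V →ₗ[K] K) (U W : Submodule K V) (S : Submodule K U) :
    Submodule K W :=
  ((S.map U.subtype).orthogonalBilin f).comap W.subtype

/-- `IsProjectivity f n U W φ`: the map `φ` is the composition of `n` consecutive perspectivities
between opposite singular subspaces, the first one starting at `U`, the last one ending at `W`. -/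
inductive IsProjectivity (f : V →ₛₗ[σ] V →ₗ[K] K) :
    ℕ → (U W : Submodule K V) → (Submodule K U → Submodule K W) → Prop
  | refl (U : Submodule K V) : IsProjectivity f 0 U U id
  | step {n : ℕ} {U W X : Submodule K V} {φ : Submodule K U → Submodule K W}
      (h : IsProjectivity f n U W φ) (hWX : Opposite f W X) :
      IsProjectivity f (n + 1) U X (perspectivity f W X ∘ φ)

lemma mem_perspectivity {f : V →ₛₗ[σ] V →ₗ[K] K} {U W : Submodule K V} {S : Submodule K U}
    {w : W} : w ∈ perspectivity f U W S ↔ ∀ s ∈ S, f (s : V) (w : V) = 0 := by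
  simp [perspectivity, Submodule.mem_orthogonalBilin_iff]

lemma IsProjectivity.trans {f : V →ₛₗ[σ] V →ₗ[K] K} {m n : ℕ} {U W X : Submodule K V}
    {φ : Submodule K U → Submodule K W} {ψ : Submodule K W → Submodule K X}
    (h : IsProjectivity f m U W φ) (h' : IsProjectivity f n W X ψ) :
    IsProjectivity f (m + n) U X (ψ ∘ φ) := by
  induction h' with
  | refl W => exact h
  | step _ hWX ih => exact (ih h).step hWX

lemma isProjectivity_perspectivity {f : V →ₛₗ[σ] V →ₗ[K] K} {U W : Submodule K V}
    (h : Opposite f U W) : IsProjectivity f 1 U W (perspectivity f U W) :=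
  (IsProjectivity.refl U).step h

/-- Every linear functional on `W` is represented by a vector of an opposite subspace. -/
lemma Opposite.exists_rep {f : V →ₛₗ[σ] V →ₗ[K] K} {U W : Submodule K V}
    (h : Opposite f U W) {r : ℕ} (hf : IsHermitianPolarSpace f r) (φ : W →ₗ[K] K) :
    ∃ u ∈ U, ∀ w : W, f u w = φ w := by
  have := h.finite_left
  have := h.finite_right
  let b := finBasis K U
  let T : U →ₛₗ[σ] Dual K W :=
    { toFun := fun u => (f u).comp W.subtype
      map_add' := fun x y => by ext; simp
      map_smul' := fun c x => by ext; simp }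
  have hT : Function.Injective T := by
    rw [injective_iff_map_eq_zero]
    intro u hu
    have : (u : V) ∈ U ⊓ W.orthogonalBilin f := by
      refine ⟨u.2, fun w hw => ?_⟩
      have h1 := LinearMap.congr_fun hu ⟨w, hw⟩
      exact hf.hermitian.isRefl _ _ h1
    rw [h.disjoint] at this
    simpa using this
  have hli : LinearIndependent K (T ∘ b) :=
    b.linearIndependent.map_of_injective_injective σ T.toAddMonoidHom
      (fun c hc => (map_eq_zero σ).1 hc) (fun m hm => hT (by simpa using hm))
      (fun c m => by simp [hf.involutive])
  have hsp := hli.span_eq_top_of_card_eq_finrank' (by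
    rw [Subspace.dual_finrank_eq, ← h.finrank_eq, Fintype.card_fin])
  have hφ : φ ∈ Submodule.span K (Set.range (T ∘ b)) := hsp ▸ Submodule.mem_top
  obtain ⟨c, hc⟩ := (Submodule.mem_span_range_iff_exists_fun K).1 hφ
  refine ⟨((∑ i, σ (c i) • b i : U) : V), Subtype.property _, fun w => ?_⟩
  have : T (∑ i, σ (c i) • b i) = φ := by
    rw [← hc, map_sum]
    exact Finset.sum_congr rfl fun i _ => by simp [hf.involutive]
  exact LinearMap.congr_fun this w

lemma Opposite.symm {f : V →ₛₗ[σ] V →ₗ[K] K} {U W : Submodule K V}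
    (h : Opposite f U W) {r : ℕ} (hf : IsHermitianPolarSpace f r) : Opposite f W U := by
  refine ⟨h.right, h.left, h.finite_right, h.finite_left, h.finrank_eq.symm, ?_⟩
  rw [eq_bot_iff]
  rintro w ⟨hw, hwU⟩
  have key : (⟨w, hw⟩ : W) = 0 := by
    rw [← Module.forall_dual_apply_eq_zero_iff K]
    intro φ
    obtain ⟨u, hu, hrep⟩ := h.exists_rep hf φ
    rw [← hrep]
    exact hwU u hu
  simpa using congrArg Subtype.val key

/-- The perspectivity from `W` to `U` is inverse to the one from `U` to `W`. -/
lemma Opposite.perspectivity_comp {f : V →ₛₗ[σ] V →ₗ[K] K} {U W : Submodule K V}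
    (h : Opposite f U W) {r : ℕ} (hf : IsHermitianPolarSpace f r) :
    perspectivity f W U ∘ perspectivity f U W = id := by
  funext S
  ext u
  simp only [Function.comp_apply, id_eq, mem_perspectivity]
  constructor
  · intro hu
    by_contra hS
    obtain ⟨φ, hφu, hφ⟩ := Submodule.exists_le_ker_of_notMem hS
    obtain ⟨w, hw, hrep⟩ := (h.symm hf).exists_rep hf φ
    refine hφu ?_
    rw [← hrep]
    refine hu ⟨w, hw⟩ fun s hs => hf.hermitian.isRefl _ _ ?_
    rw [hrep]
    exact hφ hs
  · intro hu w hw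
    exact hf.hermitian.isRefl _ _ (hw u hu)

lemma IsProjectivity.exists_inv {f : V →ₛₗ[σ] V →ₗ[K] K} {r : ℕ} (hf : IsHermitianPolarSpace f r) {n : ℕ}
    {U W : Submodule K V} {φ : Submodule K U → Submodule K W} (h : IsProjectivity f n U W φ) :
    ∃ ψ, IsProjectivity f n W U ψ ∧ ψ ∘ φ = id := by
  induction h with
  | refl U => exact ⟨id, .refl U, rfl⟩
  | @step n U W X φ _ hWX ih =>
    obtain ⟨ψ, hψ, hψφ⟩ := ih
    refine ⟨ψ ∘ perspectivity f X W, ?_, ?_⟩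
    · rw [Nat.add_comm]
      exact (isProjectivity_perspectivity (hWX.symm hf)).trans hψ
    · rw [Function.comp_assoc, ← Function.comp_assoc _ _ φ, hWX.perspectivity_comp hf,
        Function.id_comp, hψφ]

lemma IsProjectivity.perm_inv {f : V →ₛₗ[σ] V →ₗ[K] K} {r : ℕ} (hf : IsHermitianPolarSpace f r) {n : ℕ}
    {U : Submodule K V} {g : Equiv.Perm (Submodule K U)} (h : IsProjectivity f n U U g) :
    IsProjectivity f n U U (g⁻¹ : Equiv.Perm (Submodule K U)) := by
  obtain ⟨ψ, hψ, hψg⟩ := h.exists_inv hf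
  have : ψ = (g⁻¹ : Equiv.Perm (Submodule K U)) := by
    funext S
    have := congrFun hψg (g⁻¹ S)
    simpa using this
  exact this ▸ hψ

/-- The general projectivity group `Π(U)`: all self-projectivities of `U`, as permutations of the
set of subspaces of `U`. -/
def generalProjectivityGroup {f : V →ₛₗ[σ] V →ₗ[K] K} {r : ℕ}
    (hf : IsHermitianPolarSpace f r) (U : Submodule K V) :
    Subgroup (Equiv.Perm (Submodule K U)) where
  carrier := {g | ∃ n, IsProjectivity f n U U g}
  one_mem' := ⟨0, .refl U⟩
  mul_mem' := by
    rintro a b ⟨m, hm⟩ ⟨n, hn⟩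
    exact ⟨n + m, hn.trans hm⟩
  inv_mem' := by
    rintro a ⟨m, hm⟩
    exact ⟨m, hm.perm_inv hf⟩

/-- The special projectivity group `Π⁺(U)`: all self-projectivities of `U` which are the
composition of an even number of perspectivities. -/
def specialProjectivityGroup {f : V →ₛₗ[σ] V →ₗ[K] K} {r : ℕ}
    (hf : IsHermitianPolarSpace f r) (U : Submodule K V) :
    Subgroup (Equiv.Perm (Submodule K U)) where
  carrier := {g | ∃ n, Even n ∧ IsProjectivity f n U U g}
  one_mem' := ⟨0, Even.zero, .refl U⟩
  mul_mem' := by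
    rintro a b ⟨m, hm, hm'⟩ ⟨n, hn, hn'⟩
    exact ⟨n + m, hn.add hm, hn'.trans hm'⟩
  inv_mem' := by
    rintro a ⟨m, hm, hm'⟩
    exact ⟨m, hm, hm'.perm_inv hf⟩

/-! ### Polarities and linear groups -/

/-- `ρ` is a (non-degenerate) polarity of the projective space of `U` with companion field
automorphism `σ`: it maps every subspace to its orthogonal with respect to a non-degenerate
reflexive form which is `σ`-linear in the first and linear in the second variable. -/
def IsPolarity (σ : K →+* K) {U : Type*} [AddCommGroup U] [Module K U]
    (ρ : Equiv.Perm (Submodule K U)) : Prop :=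
  ∃ B : U →ₛₗ[σ] U →ₗ[K] K, B.IsRefl ∧ B.Nondegenerate ∧
    ∀ S : Submodule K U, ρ S = S.orthogonalBilin B

/-- The group `SL_r(K; F)` of invertible `r × r` matrices over `K` with determinant in the
subfield `F`. -/
def SLOver (r : ℕ) (F : Subfield K) : Subgroup (Matrix.GeneralLinearGroup (Fin r) K) where
  carrier := {M | (M : Matrix (Fin r) (Fin r) K).det ∈ F}
  one_mem' := by simp [F.one_mem]
  mul_mem' := by
    intro a b ha hb
    simpa using F.mul_mem ha hb
  inv_mem' := by
    intro a ha
    simpa [Matrix.coe_units_inv, Matrix.det_nonsing_inv] using F.inv_mem ha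

/-- The group `PSL_r(K; F)`: the quotient of `SL_r(K; F)` by its centre. -/
abbrev PSLOver (r : ℕ) (F : Subfield K) : Type _ :=
  SLOver r F ⧸ Subgroup.center (SLOver r F)

/-- The image of a subspace of `K ^ r` under an invertible matrix. -/
def matrixImage {r : ℕ} (M : Matrix.GeneralLinearGroup (Fin r) K)
    (S : Submodule K (Fin r → K)) : Submodule K (Fin r → K) :=
  S.map (Matrix.mulVecLin (M : Matrix (Fin r) (Fin r) K))

end HermitianPolar

open HermitianPolar

namespace HermitianPolar

open Module Matrix

/-! ### Group-theoretic packaging -/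

section Group

variable {G P Q : Type*} [Group G] [Group P] [Group Q]

/-! Identify `U` with `K ^ r`. The perspectivity between two opposite subspaces depends only on the
Gram matrix `A` between their bases: it is the polar map `S ↦ S^⊥` of `A`. Composing the polar maps
of `A₁` and then `A₂` gives the linear action of `A₂⁻¹ A₁^*` (`polarMap_polarMap`), so parity
decides between collineation and duality.

Lower bound. Complete the basis `u` of `U` to a hyperbolic frame `u, w` and let `v` be orthogonal to
the frame. The vectors `u j + ∑ A i j • w i + l j • v` span a singular subspace `X` exactly when `A
+ A^*` cancels the Gram matrix of the terms `l j • v`. The path from `U` through `X` and the span of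
`w` back to `U` then acts as the polar map of `A` (`exists_isProjectivity_three`). With `v = 0`
every skew-Hermitian `A` occurs, hence every polarity, and two such paths realise every invertible
Hermitian matrix. These generate all matrices with determinant in `F` (`mem_of_hermitian_mem`). If
the anisotropic part is non-trivial, some `v` has `f v v ≠ 0`, which adds `diag (d, 1, …, 1)` for
`d` outside `F`, hence all of `GL_r`.

Upper bound. Two consecutive perspectivities are induced by a linear isomorphism, so `Π⁺` always
acts through `GL_r`. In a hyperbolic space this isomorphism extends to an isometry of `V` of
determinant one (`Opposite.exists_isometry`). An even self-projectivity is thus the restriction of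
such an isometry, whose diagonal blocks are `M` and the inverse of `M^*`, so `det M = σ (det M)`.

The kernel of the action consists of the scalars. A polarity is an odd projectivity of order two
reversing inclusion, so it lies outside `Π⁺` and splits `Π` over it. -/

lemma exists_quotient_mulEquiv (π : G →* P) {C : Subgroup G} [C.Normal] (hker : π.ker = C)
    {N : Subgroup P} (hrange : π.range = N) :
    ∃ Φ : G ⧸ C ≃* N, ∀ g : G, (Φ (QuotientGroup.mk g) : P) = π g :=
  ⟨(QuotientGroup.quotientMulEquivOfEq hker.symm).trans
    ((QuotientGroup.quotientKerEquivRange π).trans (MulEquiv.subgroupCongr hrange)),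
    fun _ => rfl⟩

/-- A subgroup generated by a normal subgroup `N` of index two and an involution outside `N` is a
semidirect product. -/
lemma exists_semidirectProduct_mulEquiv {N H : Subgroup P} (hNH : N ≤ H) (Φ : Q ≃* N) {ρ : P}
    (hρ : ρ ∈ H) (hρN : ρ ∉ N) (hρρ : ρ * ρ = 1) (hcov : ∀ g ∈ H, g ∈ N ∨ g * ρ ∈ N)
    (hnorm : ∀ n ∈ N, ρ * n * ρ⁻¹ ∈ N) :
    ∃ (α : Subgroup.zpowers ρ →* MulAut Q) (Ψ : Q ⋊[α] Subgroup.zpowers ρ ≃* H),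
      (∀ q, (Ψ (SemidirectProduct.inl q) : P) = Φ q) ∧
        ∀ h : Subgroup.zpowers ρ, (Ψ (SemidirectProduct.inr h) : P) = h := by
  have hinv : ρ⁻¹ = ρ := inv_eq_of_mul_eq_one_left hρρ
  have hle : Subgroup.zpowers ρ ≤ Subgroup.normalizer (N : Set P) := by
    rw [Subgroup.zpowers_le, Subgroup.mem_normalizer_iff]
    refine fun n => ⟨hnorm n, fun hn => ?_⟩
    have := hnorm _ hn
    rwa [hinv, mul_assoc, mul_assoc, mul_assoc, hρρ, mul_one, ← mul_assoc, hρρ, one_mul] at this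
  have hzH : Subgroup.zpowers ρ ≤ H := by rwa [Subgroup.zpowers_le]
  -- Even powers of `ρ` are trivial and odd powers equal `ρ`, which is not in `N`.
  have hz : ∀ h ∈ Subgroup.zpowers ρ, h ∈ N → h = 1 := by
    rintro _ ⟨k, rfl⟩ hk
    have hsq : ρ ^ (2 : ℤ) = 1 := by rw [zpow_two, hρρ]
    rcases Int.even_or_odd' k with ⟨m, rfl | rfl⟩
    · simp only [_root_.zpow_mul, hsq, _root_.one_zpow]
    · simp only [_root_.zpow_add, _root_.zpow_mul, hsq, _root_.one_zpow, zpow_one, one_mul] at hk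
      exact absurd hk hρN
  let α : Subgroup.zpowers ρ →* MulAut Q :=
    ((MulAut.congr Φ.symm).toMonoidHom.comp N.normalizerMonoidHom).comp (Subgroup.inclusion hle)
  have hα : ∀ h q, (Φ (α h q) : P) = h * Φ q * (h : P)⁻¹ := by
    intro h q
    simp [α, MulAut.congr]
  let Ψ : Q ⋊[α] Subgroup.zpowers ρ →* H := SemidirectProduct.lift
    ((Subgroup.inclusion hNH).comp Φ.toMonoidHom) (Subgroup.inclusion hzH) (by
      intro h
      ext q
      simp [hα])
  have hΨ : ∀ x, (Ψ x : P) = Φ x.left * x.right := fun x => rfl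
  have hbij : Function.Bijective Ψ := by
    constructor
    · rw [injective_iff_map_eq_one]
      intro x hx
      have h1 : (Φ x.left : P) * x.right = 1 := by rw [← hΨ, hx]; rfl
      have h2 : (x.right : P) = 1 := by
        refine hz _ x.right.2 ?_
        rw [← inv_eq_of_mul_eq_one_right h1]
        exact N.inv_mem (Φ x.left).2
      rw [h2, mul_one] at h1
      refine SemidirectProduct.ext ?_ (Subtype.ext h2)
      exact (map_eq_one_iff Φ Φ.injective).1 (Subtype.ext h1)
    · rintro ⟨g, hg⟩
      rcases hcov g hg with h | h
      · refine ⟨⟨Φ.symm ⟨g, h⟩, 1⟩, Subtype.ext ?_⟩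
        rw [hΨ]
        simp
      · refine ⟨⟨Φ.symm ⟨g * ρ, h⟩, ⟨ρ, Subgroup.mem_zpowers ρ⟩⟩, Subtype.ext ?_⟩
        rw [hΨ]
        simp [mul_assoc, hρρ]
  refine ⟨α, MulEquiv.ofBijective Ψ hbij, fun q => ?_, fun h => ?_⟩
  · simp [hΨ]
  · simp [hΨ]

end Group

section Matrix

variable {K : Type*} [Field K] {σ : K →+* K} {r : ℕ}

/-! ### Matrices and involutions -/

/-- The conjugate transpose of a matrix with respect to a field endomorphism. -/
def conjTransposeBy (σ : K →+* K) (A : Matrix (Fin r) (Fin r) K) : Matrix (Fin r) (Fin r) K :=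
  (A.map σ)ᵀ

@[simp]
lemma conjTransposeBy_apply (A : Matrix (Fin r) (Fin r) K) (i j : Fin r) :
    conjTransposeBy σ A i j = σ (A j i) := rfl

lemma conjTransposeBy_smul (c : K) (A : Matrix (Fin r) (Fin r) K) :
    conjTransposeBy σ (c • A) = σ c • conjTransposeBy σ A := by
  ext; simp

lemma conjTransposeBy_add (A B : Matrix (Fin r) (Fin r) K) :
    conjTransposeBy σ (A + B) = conjTransposeBy σ A + conjTransposeBy σ B := by
  ext; simp

lemma conjTransposeBy_diagonal (d : Fin r → K) :
    conjTransposeBy σ (diagonal d) = diagonal (σ ∘ d) := by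
  ext i j
  rcases eq_or_ne i j with rfl | hij
  · simp
  · simp [hij, hij.symm]

lemma conjTransposeBy_conjTransposeBy (hσ : ∀ a, σ (σ a) = a) (A : Matrix (Fin r) (Fin r) K) :
    conjTransposeBy σ (conjTransposeBy σ A) = A := by
  ext; simp [hσ]

lemma det_conjTransposeBy (A : Matrix (Fin r) (Fin r) K) :
    (conjTransposeBy σ A).det = σ A.det := by
  rw [conjTransposeBy, det_transpose, ← RingHom.mapMatrix_apply, ← RingHom.map_det]

/-! ### Polar maps of sesquilinear forms on `K ^ r`. -/

/-- The map `S ↦ S^⊥` on the subspaces of `K ^ r`, for the sesquilinear form with matrix `A`. -/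
def polarMap (σ : K →+* K) (A : Matrix (Fin r) (Fin r) K) (S : Submodule K (Fin r → K)) :
    Submodule K (Fin r → K) where
  carrier := {y | ∀ s ∈ S, (σ ∘ s) ⬝ᵥ A *ᵥ y = 0}
  zero_mem' := by simp
  add_mem' {u v} hu hv s hs := by simp [mulVec_add, dotProduct_add, hu s hs, hv s hs]
  smul_mem' c y hy s hs := by simp [mulVec_smul, hy s hs]

lemma mem_polarMap {A : Matrix (Fin r) (Fin r) K} {S : Submodule K (Fin r → K)} {y : Fin r → K} :
    y ∈ polarMap σ A S ↔ ∀ s ∈ S, (σ ∘ s) ⬝ᵥ A *ᵥ y = 0 := Iff.rfl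

lemma polarMap_smul {c : K} (hc : c ≠ 0) (A : Matrix (Fin r) (Fin r) K) :
    polarMap σ (c • A) = polarMap σ A := by
  ext S y
  simp [mem_polarMap, smul_mulVec, hc]

lemma apply_dotProduct_mulVec (hσ : ∀ a, σ (σ a) = a) (A : Matrix (Fin r) (Fin r) K)
    (x y : Fin r → K) :
    σ ((σ ∘ x) ⬝ᵥ A *ᵥ y) = (σ ∘ y) ⬝ᵥ conjTransposeBy σ A *ᵥ x := by
  simp only [dotProduct, mulVec, map_sum, map_mul, Finset.mul_sum, Function.comp_apply, hσ,
    conjTransposeBy_apply]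
  rw [Finset.sum_comm]
  refine Finset.sum_congr rfl fun i _ => Finset.sum_congr rfl fun j _ => by ring

lemma mem_matrixImage {M : GL (Fin r) K} {S : Submodule K (Fin r → K)} {y : Fin r → K} :
    y ∈ matrixImage M S ↔ ∃ s ∈ S, (M : Matrix (Fin r) (Fin r) K) *ᵥ s = y := by
  simp [matrixImage]

/-- The matrix `M` is `A₂⁻¹ A₁^*`: pairing `y` with `M s` through `A₂` gives the `σ`-conjugate of
the pairing of `s` with `y` through `A₁`. The claim is then that the double annihilator of `S` is
`S`. -/
lemma polarMap_polarMap (hσ : ∀ a, σ (σ a) = a) {A₁ A₂ : Matrix (Fin r) (Fin r) K}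
    (hA₁ : A₁.det ≠ 0) {M : GL (Fin r) K}
    (hM : A₂ * (M : Matrix (Fin r) (Fin r) K) = conjTransposeBy σ A₁)
    (S : Submodule K (Fin r → K)) :
    polarMap σ A₂ (polarMap σ A₁ S) = matrixImage M S := by
  have key : ∀ y s, (σ ∘ y) ⬝ᵥ A₂ *ᵥ ((M : Matrix (Fin r) (Fin r) K) *ᵥ s) =
      σ ((σ ∘ s) ⬝ᵥ A₁ *ᵥ y) := by
    intro y s
    rw [apply_dotProduct_mulVec hσ, mulVec_mulVec, hM]
  ext z
  rw [mem_matrixImage]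
  constructor
  · intro hz
    set z' := ((M⁻¹ : GL (Fin r) K) : Matrix (Fin r) (Fin r) K) *ᵥ z with hz'
    have hMz : (M : Matrix (Fin r) (Fin r) K) *ᵥ z' = z := by
      rw [hz', mulVec_mulVec, ← Units.val_mul, mul_inv_cancel, Units.val_one, one_mulVec]
    refine ⟨z', ?_, hMz⟩
    by_contra hS
    obtain ⟨φ, hφz, hφ⟩ := Submodule.exists_le_ker_of_notMem hS
    have hdot : ∀ t : Fin r → K, φ t = t ⬝ᵥ fun i => φ (Pi.single i 1) := by
      intro t
      conv_lhs => rw [← Finset.univ_sum_single t]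
      rw [map_sum]
      refine Finset.sum_congr rfl fun i _ => ?_
      rw [← mul_one (t i), ← smul_eq_mul, Pi.single_smul, map_smul]
      simp
    set p : Fin r → K := fun i => φ (Pi.single i 1)
    have hA : A₁ *ᵥ (A₁⁻¹ *ᵥ (σ ∘ p)) = σ ∘ p := by
      rw [mulVec_mulVec, mul_nonsing_inv _ (isUnit_iff_ne_zero.2 hA₁), one_mulVec]
    have hσp : ∀ t : Fin r → K, (σ ∘ t) ⬝ᵥ (σ ∘ p) = σ (φ t) := by
      intro t
      rw [hdot, dotProduct, dotProduct, map_sum]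
      simp
    -- This test vector represents, through `A₁` and up to `σ`, a functional that vanishes on `S`
    -- but not at `z'`.
    have h1 := hz (A₁⁻¹ *ᵥ (σ ∘ p)) (fun s hs => by
      rw [hA, hσp, show φ s = 0 from hφ hs, map_zero])
    rw [← hMz, key, hA, hσp, hσ] at h1
    exact hφz h1
  · rintro ⟨s, hs, rfl⟩ y hy
    rw [key, hy s hs, map_zero]

/-! ### The involution, scalar matrices and reflexive forms. -/

/-- Hilbert's theorem 90 for an involution. -/
lemma exists_ne_zero_apply_mul_eq (hσ : ∀ a, σ (σ a) = a) (hσ' : σ ≠ RingHom.id K) {μ : K}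
    (hμ : μ * σ μ = 1) : ∃ c : K, c ≠ 0 ∧ σ c * μ = c := by
  by_contra! h
  -- Every `c = a + μ * σ a` satisfies the equation, so failure forces all of these to vanish.
  have h0 : ∀ a, a + μ * σ a = 0 := by
    intro a
    by_contra ha
    refine h _ ha ?_
    rw [map_add, map_mul, hσ]
    linear_combination a * hμ
  have h1 : μ = -1 := by
    have := h0 1
    rw [map_one] at this
    linear_combination this
  refine hσ' (RingHom.ext fun a => ?_)
  have := h0 a
  rw [h1] at this
  simp only [RingHom.id_apply]
  linear_combination -this

lemma exists_ne_zero_apply_eq_neg (hσ : ∀ a, σ (σ a) = a) (hσ' : σ ≠ RingHom.id K) :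
    ∃ c : K, c ≠ 0 ∧ σ c = -c := by
  obtain ⟨c, hc, h⟩ := exists_ne_zero_apply_mul_eq hσ hσ' (μ := -1) (by simp)
  exact ⟨c, hc, by linear_combination -h⟩

/-- If the trace `a + σ a` vanished identically, then `1 + 1 = 0` and `σ a = -a = a`. The element
`τ` replaces `1 / 2` in every characteristic. -/
lemma exists_add_apply_eq_one (hσ : ∀ a, σ (σ a) = a) (hσ' : σ ≠ RingHom.id K) :
    ∃ τ : K, τ + σ τ = 1 := by
  obtain ⟨a, ha⟩ : ∃ a, a + σ a ≠ 0 := by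
    by_contra! h
    have h1 := h 1
    rw [map_one] at h1
    refine hσ' (RingHom.ext fun a => ?_)
    simp only [RingHom.id_apply]
    linear_combination h a - a * h1
  refine ⟨a / (a + σ a), ?_⟩
  rw [map_div₀, map_add, hσ, add_comm (σ a) a]
  field_simp

/-- Fixing every line makes every vector an eigenvector. -/
lemma exists_scalar_of_matrixImage_eq {M : GL (Fin r) K} (h : ∀ S, matrixImage M S = S) :
    ∃ a : K, (M : Matrix (Fin r) (Fin r) K) = scalar (Fin r) a := by
  obtain ⟨a, ha⟩ := LinearMap.exists_eq_smul_id_of_forall_notLinearIndependent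
    (f := mulVecLin (M : Matrix (Fin r) (Fin r) K)) (by
      intro v hv
      have h1 : (M : Matrix (Fin r) (Fin r) K) *ᵥ v ∈ matrixImage M (K ∙ v) :=
        mem_matrixImage.2 ⟨v, Submodule.mem_span_singleton_self v, rfl⟩
      rw [h, Submodule.mem_span_singleton] at h1
      obtain ⟨c, hc⟩ := h1
      rw [LinearIndependent.pair_iff] at hv
      simpa using (hv c (-1) (by simp [← hc])).2)
  refine ⟨a, ?_⟩
  have := congrArg LinearMap.toMatrix' ha
  rw [← Matrix.toLin'_apply', LinearMap.toMatrix'_toLin'] at this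
  rw [this, map_smul, LinearMap.toMatrix'_one]
  ext i j
  simp [diagonal_apply, one_apply]

lemma matrixImage_of_scalar {M : GL (Fin r) K} {a : K}
    (h : (M : Matrix (Fin r) (Fin r) K) = scalar (Fin r) a) (S : Submodule K (Fin r → K)) :
    matrixImage M S = S := by
  -- For `r = 0` the scalar `a` may be zero, so this case is separate.
  rcases isEmpty_or_nonempty (Fin r) with hr | hr
  · exact Subsingleton.elim _ _
  have ha : a ≠ 0 := by
    rintro rfl
    exact M.ne_zero (by rw [h, map_zero])
  ext y
  rw [mem_matrixImage, h]
  constructor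
  · rintro ⟨s, hs, rfl⟩
    have : (scalar (Fin r) a) *ᵥ s = a • s := by ext; simp [mulVec_diagonal]
    exact this ▸ S.smul_mem a hs
  · intro hy
    exact ⟨a⁻¹ • y, S.smul_mem _ hy, by ext; simp [mulVec_diagonal, ha]⟩

lemma polarMap_conjTransposeBy (hσ : ∀ a, σ (σ a) = a) {A : Matrix (Fin r) (Fin r) K}
    (hrefl : ∀ x y, (σ ∘ x) ⬝ᵥ A *ᵥ y = 0 → (σ ∘ y) ⬝ᵥ A *ᵥ x = 0) :
    polarMap σ (conjTransposeBy σ A) = polarMap σ A := by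
  ext S y
  refine forall₂_congr fun s _ => ?_
  rw [← apply_dotProduct_mulVec hσ, map_eq_zero]
  exact ⟨hrefl _ _, hrefl _ _⟩

/-- A non-degenerate reflexive sesquilinear form is proportional to a skew-Hermitian one. -/
lemma exists_smul_skewHermitian (hσ : ∀ a, σ (σ a) = a) (hσ' : σ ≠ RingHom.id K)
    {A : Matrix (Fin r) (Fin r) K} (hA : A.det ≠ 0)
    (hrefl : ∀ x y, (σ ∘ x) ⬝ᵥ A *ᵥ y = 0 → (σ ∘ y) ⬝ᵥ A *ᵥ x = 0) :
    ∃ c : K, c ≠ 0 ∧ conjTransposeBy σ (c • A) = -(c • A) := by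
  rcases isEmpty_or_nonempty (Fin r) with hr | hr
  · exact ⟨1, one_ne_zero, Subsingleton.elim _ _⟩
  have hA' : (conjTransposeBy σ A).det ≠ 0 := by
    rw [det_conjTransposeBy]; simpa using hA
  obtain ⟨M, hM⟩ : ∃ M : GL (Fin r) K, A * (M : Matrix (Fin r) (Fin r) K) =
      conjTransposeBy σ A := by
    refine ⟨(GeneralLinearGroup.mkOfDetNeZero A hA)⁻¹ *
      GeneralLinearGroup.mkOfDetNeZero (conjTransposeBy σ A) hA', ?_⟩
    have := congrArg Units.val (mul_inv_cancel_left (GeneralLinearGroup.mkOfDetNeZero A hA)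
      (GeneralLinearGroup.mkOfDetNeZero (conjTransposeBy σ A) hA'))
    exact this
  -- By reflexivity `A` and `A^*` have the same polar map, so the action of `M = A⁻¹ A^*` equals
  -- that of `A⁻¹ A = 1`.
  obtain ⟨a, ha⟩ := exists_scalar_of_matrixImage_eq (M := M) (by
    intro S
    have h1 : matrixImage 1 S = S := matrixImage_of_scalar (M := 1) (a := 1) (by simp) S
    rw [← polarMap_polarMap hσ hA' (A₂ := A)
      (by simp [conjTransposeBy_conjTransposeBy hσ])] at h1
    rw [← polarMap_polarMap hσ hA hM S]
    rwa [polarMap_conjTransposeBy hσ hrefl] at h1)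
  have haA : conjTransposeBy σ A = a • A := by
    rw [← hM, ha]
    ext i j
    simp [mul_comm]
  have haa : a * σ a = 1 := by
    have h1 := conjTransposeBy_conjTransposeBy hσ A
    rw [haA, conjTransposeBy_smul, haA, smul_smul] at h1
    obtain ⟨i, j, hij⟩ : ∃ i j, A i j ≠ 0 := by
      by_contra! h
      exact hA (by rw [show A = 0 from ext h, det_zero])
    have h2 := congrFun₂ h1 i j
    simp only [Matrix.smul_apply, smul_eq_mul] at h2
    exact mul_right_cancel₀ hij (by rw [one_mul, mul_comm a, h2])
  -- Using `-a` instead of `a` makes the rescaled form skew-Hermitian rather than Hermitian.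
  obtain ⟨c, hc, hcc⟩ := exists_ne_zero_apply_mul_eq hσ hσ' (μ := -a) (by simpa using haa)
  refine ⟨c, hc, ?_⟩
  rw [conjTransposeBy_smul, haA, smul_smul, ← neg_smul]
  congr 1
  linear_combination -hcc

/-! ### Generation of matrix groups by Hermitian matrices. -/

/-- The Hermitian matrix with entries `a` and `σ a` in the positions `(i, j)` and `(j, i)`, and equal
to the identity matrix in the other rows. -/
def hermitianSwap (σ : K →+* K) (i j : Fin r) (a : K) : Matrix (Fin r) (Fin r) K :=
  (diagonal fun k => if k = i then a else if k = j then σ a else 1).submatrix id (Equiv.swap i j)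

lemma hermitianSwap_apply (i j : Fin r) (a : K) (k l : Fin r) :
    hermitianSwap σ i j a k l =
      if k = Equiv.swap i j l then if k = i then a else if k = j then σ a else 1 else 0 := by
  simp [hermitianSwap, diagonal_apply]

lemma det_hermitianSwap_ne_zero (i j : Fin r) {a : K} (ha : a ≠ 0) :
    (hermitianSwap σ i j a).det ≠ 0 := by
  rw [hermitianSwap, det_permute', det_diagonal]
  refine mul_ne_zero ?_ (Finset.prod_ne_zero_iff.2 fun k _ => ?_)
  · rcases Int.units_eq_one_or (Equiv.Perm.sign (Equiv.swap i j)) with h | h <;> simp [h]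
  · split_ifs <;> simp [ha]

lemma conjTransposeBy_hermitianSwap (hσ : ∀ a, σ (σ a) = a) {i j : Fin r} (hij : i ≠ j) (a : K) :
    conjTransposeBy σ (hermitianSwap σ i j a) = hermitianSwap σ i j a := by
  ext k l
  simp only [conjTransposeBy_apply, hermitianSwap_apply, Equiv.swap_apply_def]
  split_ifs <;> grind

/-- The result is a diagonal matrix with entries fixed by the involution. Hence the swap matrix
times a transvection is again Hermitian, and the transvection is a quotient of two Hermitian
matrices. -/
lemma hermitianSwap_mul_single {i j : Fin r} (hij : i ≠ j) (a : K) :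
    hermitianSwap σ i j a * single i j a = diagonal (Pi.single j (σ a * a)) := by
  ext k l
  rcases eq_or_ne l j with rfl | hl
  · rw [mul_single_apply_same]
    simp only [hermitianSwap_apply, diagonal_apply, Equiv.swap_apply_left, Pi.single_apply]
    split_ifs <;> grind
  · rw [mul_single_apply_of_ne _ _ _ _ _ hl]
    simp only [diagonal_apply, Pi.single_apply]
    split_ifs <;> grind

/-- Dividing the entry `σ a` by the norm `a * σ a`, which lies in the fixed field, turns this
product into `diag (a, a⁻¹)`. -/
lemma hermitianSwap_mul_hermitianSwap_one {i j : Fin r} (a : K) :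
    hermitianSwap σ i j a * hermitianSwap σ i j 1 =
      diagonal fun k => if k = i then a else if k = j then σ a else 1 := by
  have h1 : hermitianSwap σ i j 1 =
      (1 : Matrix (Fin r) (Fin r) K).submatrix (Equiv.swap i j) id := by
    ext k l
    simp only [hermitianSwap_apply, submatrix_apply, one_apply, id_eq, map_one, ite_self,
      Equiv.swap_apply_eq_iff]
  rw [h1, hermitianSwap, submatrix_mul_equiv, Matrix.mul_one, submatrix_id_id]

/-- A subgroup containing all invertible Hermitian matrices contains all invertible matrices whose
determinant is fixed by the involution. -/
lemma mem_of_hermitian_mem (hσ : ∀ a, σ (σ a) = a) {Γ : Subgroup (GL (Fin r) K)}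
    (hΓ : ∀ H : GL (Fin r) K,
      conjTransposeBy σ (H : Matrix (Fin r) (Fin r) K) = H → H ∈ Γ)
    (M : GL (Fin r) K) (hM : σ (M : Matrix (Fin r) (Fin r) K).det =
      (M : Matrix (Fin r) (Fin r) K).det) : M ∈ Γ := by
  set P : Matrix (Fin r) (Fin r) K → Prop :=
    fun N => ∃ g ∈ Γ, (g : Matrix (Fin r) (Fin r) K) = N
  have hPmul : ∀ A B, P A → P B → P (A * B) := by
    rintro _ _ ⟨g, hg, rfl⟩ ⟨h, hh, rfl⟩
    exact ⟨g * h, Γ.mul_mem hg hh, rfl⟩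
  have hPherm : ∀ A : Matrix (Fin r) (Fin r) K, A.det ≠ 0 → conjTransposeBy σ A = A → P A :=
    fun A hA hA' => ⟨GeneralLinearGroup.mkOfDetNeZero A hA, hΓ _ hA', rfl⟩
  have hPcancel : ∀ A B, P A → P (A * B) → P B := by
    rintro _ B ⟨g, hg, rfl⟩ ⟨h, hh, hgh⟩
    refine ⟨g⁻¹ * h, Γ.mul_mem (Γ.inv_mem hg) hh, ?_⟩
    rw [Units.val_mul, hgh, ← Matrix.mul_assoc, ← Units.val_mul, inv_mul_cancel, Units.val_one,
      Matrix.one_mul]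
  have hPdiag : ∀ d : Fin r → K, (∀ i, d i ≠ 0) → (∀ i, σ (d i) = d i) → P (diagonal d) := by
    intro d hd hd'
    refine hPherm _ (by simpa [det_diagonal, Finset.prod_ne_zero_iff] using hd) ?_
    rw [conjTransposeBy_diagonal]
    exact congrArg diagonal (funext hd')
  suffices P M by
    obtain ⟨g, hg, hgM⟩ := this
    rwa [← Units.ext hgM]
  have hMdet : (M : Matrix (Fin r) (Fin r) K).det ≠ 0 := M.isUnit.map detMonoidHom |>.ne_zero
  have hS : ∀ i j, i ≠ j → ∀ a : K, a ≠ 0 → P (hermitianSwap σ i j a) := fun i j hij a ha =>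
    hPherm _ (det_hermitianSwap_ne_zero i j ha) (conjTransposeBy_hermitianSwap hσ hij a)
  have htransvec : ∀ i j, i ≠ j → ∀ a, P (transvection i j a) := by
    intro i j hij a
    rcases eq_or_ne a 0 with rfl | ha
    · exact ⟨1, Γ.one_mem, by simp⟩
    refine hPcancel _ _ (hS i j hij a ha) (hPherm _ ?_ ?_)
    · rw [det_mul, det_transvection_of_ne _ _ hij, mul_one]
      exact det_hermitianSwap_ne_zero i j ha
    · rw [transvection, Matrix.mul_add, Matrix.mul_one, hermitianSwap_mul_single hij,
        conjTransposeBy_add, conjTransposeBy_hermitianSwap hσ hij, conjTransposeBy_diagonal]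
      congr 2
      ext k
      simp only [Function.comp_apply, Pi.single_apply]
      split_ifs <;> simp [hσ, mul_comm]
  have hdiag2 : ∀ i j, i ≠ j → ∀ a : K, a ≠ 0 →
      P (diagonal fun k => if k = i then a else if k = j then a⁻¹ else 1) := by
    intro i j hij a ha
    have h2 := hPmul _ _ (hPmul _ _ (hS i j hij a ha) (hS i j hij 1 one_ne_zero))
      (hPdiag (fun k => if k = j then (a * σ a)⁻¹ else 1) (fun k => by split_ifs <;> simp [ha])
        (fun k => by split_ifs <;> simp [hσ, mul_comm]))
    rw [hermitianSwap_mul_hermitianSwap_one, diagonal_mul_diagonal] at h2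
    have hσa : σ a ≠ 0 := by simpa using ha
    convert h2 using 3 with k
    rcases eq_or_ne k i with rfl | hki
    · simp [hij]
    · rcases eq_or_ne k j with rfl | hkj
      · simp only [hki, if_false, if_true]
        field_simp
      · simp [hki, hkj]
  rcases subsingleton_or_nontrivial (Fin r) with hr | hr
  -- In dimension at most one, a matrix with fixed determinant is itself Hermitian.
  · refine hPherm _ hMdet ?_
    ext i j
    obtain rfl := Subsingleton.elim i j
    rwa [det_eq_elem_of_subsingleton _ i] at hM
  · obtain ⟨i₀, -⟩ := exists_pair_ne (Fin r)
    set δ := (M : Matrix (Fin r) (Fin r) K).det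
    have hSL : ∀ N : SpecialLinearGroup (Fin r) K, P N := fun N =>
      SpecialLinearGroup.diagonal_transvection_induction' (fun N => P N) N
        (fun i j hij c hc => hdiag2 i j hij c hc) (fun i j hij a => htransvec i j hij a)
        (fun A B hA hB => hPmul _ _ hA hB)
    have hdet : ∀ c : K, (diagonal (Function.update (1 : Fin r → K) i₀ c)).det = c := by
      intro c
      rw [det_diagonal, Finset.prod_update_of_mem (Finset.mem_univ _)]
      simp
    -- Split off the determinant as a diagonal Hermitian factor, leaving a matrix in `SL_r`.
    have h1 := hPmul _ _ (hSL ⟨(M : Matrix (Fin r) (Fin r) K) *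
      diagonal (Function.update 1 i₀ δ⁻¹), by rw [det_mul, hdet, mul_inv_cancel₀ hMdet]⟩)
      (hPdiag (Function.update 1 i₀ δ) (fun i => by
        rw [Function.update_apply]; split_ifs <;> simp [hMdet]) (fun i => by
        rw [Function.update_apply]; split_ifs <;> simp [hM]))
    rw [Matrix.mul_assoc, diagonal_mul_diagonal] at h1
    convert h1
    rw [eq_comm]
    convert Matrix.mul_one _
    rw [← diagonal_one]
    congr 1
    ext i
    rw [Function.update_apply, Function.update_apply]
    split_ifs <;> simp [hMdet]

/-- A subgroup containing all invertible Hermitian matrices, and the matrices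
`diag (d, 1, …, 1)` for `d` not fixed by the involution, contains all invertible matrices. -/
lemma mem_of_hermitian_mem_of_diagonal_mem (hσ : ∀ a, σ (σ a) = a) {Γ : Subgroup (GL (Fin r) K)}
    (hΓ : ∀ H : GL (Fin r) K,
      conjTransposeBy σ (H : Matrix (Fin r) (Fin r) K) = H → H ∈ Γ) (i₀ : Fin r)
    (hΓ' : ∀ D : GL (Fin r) K, ∀ d : K, σ d ≠ d →
      (D : Matrix (Fin r) (Fin r) K) = diagonal (Function.update 1 i₀ d) → D ∈ Γ)
    (M : GL (Fin r) K) : M ∈ Γ := by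
  have hMdet : (M : Matrix (Fin r) (Fin r) K).det ≠ 0 := M.isUnit.map detMonoidHom |>.ne_zero
  set d := (M : Matrix (Fin r) (Fin r) K).det with hd
  by_cases hdσ : σ d = d
  · exact mem_of_hermitian_mem hσ hΓ M hdσ
  have hdet : (diagonal (Function.update (1 : Fin r → K) i₀ d)).det = d := by
    rw [det_diagonal, Finset.prod_update_of_mem (Finset.mem_univ _)]
    simp
  set D : GL (Fin r) K := GeneralLinearGroup.mkOfDetNeZero
    (diagonal (Function.update (1 : Fin r → K) i₀ d)) (by rwa [hdet])
  have hD : D ∈ Γ := hΓ' D d hdσ rfl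
  have hDdet : (D : Matrix (Fin r) (Fin r) K).det = d := hdet
  have h1 : M * D⁻¹ ∈ Γ := by
    have : ((M * D⁻¹ : GL (Fin r) K) : Matrix (Fin r) (Fin r) K).det = 1 := by
      rw [Units.val_mul, det_mul, coe_units_inv, det_nonsing_inv, hDdet, ← hd]
      simp [hMdet]
    exact mem_of_hermitian_mem hσ hΓ _ (by rw [this, map_one])
  simpa using Γ.mul_mem h1 hD

end Matrix

variable {K V : Type*} [Field K] [AddCommGroup V] [Module K V] {σ : K →+* K} {r : ℕ}
  {f : V →ₛₗ[σ] V →ₗ[K] K}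

/-! ### Singular subspaces and hyperbolic frames -/

lemma IsSingular.span {ι : Type*} {a : ι → V} (h : ∀ i j, f (a i) (a j) = 0) :
    IsSingular f (Submodule.span K (Set.range a)) := by
  intro u hu v hv
  induction hu using Submodule.span_induction with
  | zero => simp
  | add x y _ _ hx hy => simp [hx, hy]
  | smul c x _ hx => simp [hx]
  | mem x hx =>
    obtain ⟨i, rfl⟩ := hx
    induction hv using Submodule.span_induction with
    | zero => simp
    | add x y _ _ hx hy => simp [hx, hy]
    | smul c x _ hx => simp [hx]
    | mem x hx =>
      obtain ⟨j, rfl⟩ := hx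
      exact h i j

/-- A vector orthogonal to itself and to a maximal singular subspace lies in that subspace. -/
lemma mem_of_maximal (hf : f.IsSymm) {U : Submodule K V} (hU : Maximal (IsSingular f) U)
    {x : V} (hx : f x x = 0) (hUx : ∀ u ∈ U, f u x = 0) : x ∈ U := by
  have h1 : IsSingular f (U ⊔ K ∙ x) := by
    intro a ha b hb
    obtain ⟨u, hu, y, hy, rfl⟩ := Submodule.mem_sup.1 ha
    obtain ⟨u', hu', y', hy', rfl⟩ := Submodule.mem_sup.1 hb
    obtain ⟨c, rfl⟩ := Submodule.mem_span_singleton.1 hy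
    obtain ⟨c', rfl⟩ := Submodule.mem_span_singleton.1 hy'
    simp [hU.1 u hu u' hu', hx, hUx u hu, hf.isRefl _ _ (hUx u' hu')]
  exact hU.2 h1 le_sup_left (le_sup_right (a := U) (Submodule.mem_span_singleton_self x))

/-- All maximal singular subspaces have the same dimension. -/
lemma finrank_of_maximal (hΔ : IsHermitianPolarSpace f r) {U : Submodule K V}
    (hU : Maximal (IsSingular f) U) : FiniteDimensional K U ∧ finrank K U = r := by
  have fin_of : ∀ W : Submodule K V, IsSingular f W → FiniteDimensional K W := fun W hW =>
    rank_lt_aleph0_iff.1 ((hΔ.rank_le W hW).trans_lt (Cardinal.natCast_lt_aleph0))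
  have hUfin := fin_of U hU.1
  refine ⟨hUfin, le_antisymm ?_ ?_⟩
  · have := hΔ.rank_le U hU.1
    rw [← finrank_eq_rank] at this
    exact_mod_cast this
  obtain ⟨M, hM, hMr⟩ := hΔ.exists_rank
  have hMfin := fin_of M hM
  have hMr' : finrank K M = r := by
    rw [← finrank_eq_rank] at hMr
    exact_mod_cast hMr
  obtain ⟨C, hC⟩ := Submodule.exists_isCompl (M.comap U.subtype)
  have hCfin : FiniteDimensional K C := inferInstance
  -- A vector of `M` orthogonal to `C` is orthogonal to all of `U`, hence lies in `U` by maximality.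
  -- So the at most `dim C` conditions below cut `M` down to a subspace of `M ∩ U`, and `dim M ≤ dim
  -- U`.
  let b := finBasis K C
  let T : M →ₗ[K] Fin (finrank K C) → K :=
    LinearMap.pi fun i => (f ((b i : U) : V)).comp M.subtype
  have hker : ∀ m : M, T m = 0 → (m : V) ∈ U := by
    intro m hm
    refine mem_of_maximal hΔ.hermitian hU (hM m m.2 m m.2) fun u hu => ?_
    obtain ⟨x, hx, y, hy, hxy⟩ := Submodule.mem_sup.1
      (hC.sup_eq_top.symm ▸ Submodule.mem_top : (⟨u, hu⟩ : U) ∈ M.comap U.subtype ⊔ C)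
    have hu' : u = (x : V) + (y : V) := (congrArg Subtype.val hxy).symm
    have hy' : y = ∑ i, b.repr ⟨y, hy⟩ i • (b i : U) := by
      have := congrArg C.subtype (b.sum_repr ⟨y, hy⟩)
      rw [map_sum] at this
      exact this.symm
    have hTi : ∀ i, f ((b i : U) : V) m = 0 := fun i => congrFun hm i
    rw [hu', map_add, LinearMap.add_apply, hM x hx m m.2, zero_add, hy']
    simp [hTi]
  have h1 : finrank K (LinearMap.ker T) ≤ finrank K (M.comap U.subtype) := by
    let ι : LinearMap.ker T →ₗ[K] M.comap U.subtype :=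
      { toFun := fun m => ⟨⟨m, hker m.1 m.2⟩, m.1.2⟩
        map_add' := fun _ _ => rfl
        map_smul' := fun _ _ => rfl }
    refine LinearMap.finrank_le_finrank_of_injective (f := ι) fun m m' h => ?_
    have : ((m : M) : V) = (m' : M) := congrArg (fun z : M.comap U.subtype => ((z : U) : V)) h
    exact Subtype.ext (Subtype.ext this)
  have h2 := LinearMap.finrank_range_add_finrank_ker T
  have h3 : finrank K (LinearMap.range T) ≤ finrank K C :=
    (Submodule.finrank_le _).trans (by simp)
  have h4 := Submodule.finrank_add_eq_of_isCompl hC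
  omega

/-- Linearly independent vectors have a dual family with respect to a non-degenerate form. -/
lemma exists_dual_family (hΔ : IsHermitianPolarSpace f r) {ι : Type*} [Fintype ι] [DecidableEq ι]
    {u : ι → V} (hu : LinearIndependent K u) :
    ∃ v : ι → V, ∀ i j, f (u i) (v j) = if i = j then 1 else 0 := by
  let T : V →ₗ[K] ι → K := LinearMap.pi fun i => f (u i)
  have hT : LinearMap.range T = ⊤ := by
    by_contra h
    obtain ⟨φ, hφ, hφT⟩ := Submodule.exists_le_ker_of_lt_top _ (lt_top_iff_ne_top.2 h)
    -- A functional killing the range yields a combination of the `u i` in the radical.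
    have h0 : ∑ i, σ (φ (Pi.single i 1)) • u i = 0 := by
      refine hΔ.nondegenerate.1 _ fun y => ?_
      have h1 : φ (T y) = 0 := hφT ⟨y, rfl⟩
      rw [← Finset.univ_sum_single (T y), map_sum] at h1
      rw [map_sum, LinearMap.sum_apply, ← h1]
      refine Finset.sum_congr rfl fun i _ => ?_
      rw [map_smulₛₗ, hΔ.involutive, LinearMap.smul_apply, smul_eq_mul,
        show Pi.single i (T y i) = T y i • (Pi.single i 1 : ι → K) by
          rw [← Pi.single_smul, smul_eq_mul, mul_one], map_smul, smul_eq_mul, mul_comm]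
      rfl
    refine hφ (LinearMap.pi_ext' fun i => LinearMap.ext_ring ?_)
    have := Fintype.linearIndependent_iff.1 hu _ h0 i
    simpa using this
  choose v hv using fun j => LinearMap.range_eq_top.1 hT (Pi.single j 1)
  refine ⟨v, fun i j => ?_⟩
  have := congrFun (hv j) i
  simpa [T, Pi.single_apply] using this

/-- Linearly independent, pairwise orthogonal isotropic vectors extend to a hyperbolic basis of a
subspace. -/
lemma exists_hyperbolic_family (hΔ : IsHermitianPolarSpace f r) {ι : Type*} [Fintype ι]
    [DecidableEq ι] {u : ι → V} (hu : LinearIndependent K u) (huu : ∀ i j, f (u i) (u j) = 0) :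
    ∃ w : ι → V, (∀ i j, f (w i) (w j) = 0) ∧
      ∀ i j, f (u i) (w j) = if i = j then 1 else 0 := by
  obtain ⟨v, hv⟩ := exists_dual_family hΔ hu
  obtain ⟨τ, hτ⟩ := exists_add_apply_eq_one hΔ.involutive hΔ.nontrivial
  have hv' : ∀ i j, f (v i) (u j) = if i = j then 1 else 0 := by
    intro i j
    rw [← hΔ.hermitian.eq, hv]
    split_ifs <;> simp_all
  -- The correction leaves the pairings with `u` unchanged and multiplies the Gram matrix of `v` by
  -- `1 - τ - σ τ = 0`.
  refine ⟨fun j => v j - ∑ i, (τ * f (v i) (v j)) • u i, fun i j => ?_, fun i j => ?_⟩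
  · have h1 : σ (f (v j) (v i)) = f (v i) (v j) := hΔ.hermitian.eq _ _
    simp [hv, hv', huu, h1]
    linear_combination (-f (v i) (v j)) * hτ
  · simp [hv, huu]

/-! ### Perspectivities in coordinates -/

lemma apply_eq_dotProduct {U W : Submodule K V} (e : (Fin r → K) ≃ₗ[K] U)
    (e' : (Fin r → K) ≃ₗ[K] W) {A : Matrix (Fin r) (Fin r) K}
    (hA : ∀ i j, f (e (Pi.single i 1)) (e' (Pi.single j 1)) = A i j) (s t : Fin r → K) :
    f (e s) (e' t) = (σ ∘ s) ⬝ᵥ A *ᵥ t := by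
  have h1 : ∀ {X : Submodule K V} (e : (Fin r → K) ≃ₗ[K] X) (s : Fin r → K),
      (e s : V) = ∑ i, s i • (e (Pi.single i 1) : V) := by
    intro X e s
    have : s = ∑ i, s i • (Pi.single i 1 : Fin r → K) := by
      conv_lhs => rw [← Finset.univ_sum_single s]
      refine Finset.sum_congr rfl fun i _ => ?_
      rw [← Pi.single_smul, smul_eq_mul, mul_one]
    conv_lhs => rw [this, map_sum]
    simp
  rw [h1 e, h1 e']
  simp only [map_sum, LinearMap.sum_apply, map_smulₛₗ, LinearMap.smul_apply, hA, dotProduct,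
    mulVec, smul_eq_mul, Finset.mul_sum, Function.comp_apply, RingHom.id_apply]
  rw [Finset.sum_comm]
  refine Finset.sum_congr rfl fun i _ => Finset.sum_congr rfl fun j _ => by ring

/-- Only the Gram matrix between the two bases matters, so compositions of perspectivities become
matrix computations. -/
lemma perspectivity_map {U W : Submodule K V} (e : (Fin r → K) ≃ₗ[K] U)
    (e' : (Fin r → K) ≃ₗ[K] W) {A : Matrix (Fin r) (Fin r) K}
    (hA : ∀ i j, f (e (Pi.single i 1)) (e' (Pi.single j 1)) = A i j)
    (S : Submodule K (Fin r → K)) :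
    perspectivity f U W (S.map e.toLinearMap) = (polarMap σ A S).map e'.toLinearMap := by
  ext w
  obtain ⟨t, rfl⟩ := e'.surjective w
  rw [mem_perspectivity]
  constructor
  · intro h
    refine ⟨t, fun s hs => ?_, rfl⟩
    rw [← apply_eq_dotProduct e e' hA]
    exact h _ ⟨s, hs, rfl⟩
  · rintro ⟨t', ht', h⟩ _ ⟨s, hs, rfl⟩
    obtain rfl := e'.injective h
    exact (apply_eq_dotProduct e e' hA s t').trans (ht' s hs)

lemma opposite_of_det_ne_zero (hf : f.IsSymm) {U W : Submodule K V} (hU : IsSingular f U)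
    (hW : IsSingular f W) (e : (Fin r → K) ≃ₗ[K] U)
    (e' : (Fin r → K) ≃ₗ[K] W) {A : Matrix (Fin r) (Fin r) K}
    (hA : ∀ i j, f (e (Pi.single i 1)) (e' (Pi.single j 1)) = A i j) (hdet : A.det ≠ 0) :
    Opposite f U W := by
  refine ⟨hU, hW, Module.Finite.equiv e, Module.Finite.equiv e',
    by rw [← e.finrank_eq, e'.finrank_eq], ?_⟩
  rw [eq_bot_iff]
  rintro u ⟨hu, huW⟩
  obtain ⟨s, hs⟩ := e.surjective ⟨u, hu⟩
  have hsu : (e s : V) = u := congrArg Subtype.val hs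
  have h1 : (σ ∘ s) ᵥ* A = 0 := by
    refine dotProduct_eq_zero _ fun t => ?_
    rw [← dotProduct_mulVec, ← apply_eq_dotProduct e e' hA, hsu]
    exact hf.isRefl _ _ (huW _ (e' t).2)
  have h2 : σ ∘ s = 0 := by
    by_contra h
    exact hdet (exists_vecMul_eq_zero_iff.1 ⟨_, h, h1⟩)
  have h3 : s = 0 := funext fun i => by simpa using congrFun h2 i
  rw [Submodule.mem_bot, ← hsu, h3, map_zero]
  rfl

lemma exists_coordinates {a : Fin r → V} (ha : LinearIndependent K a) :
    ∃ e : (Fin r → K) ≃ₗ[K] Submodule.span K (Set.range a),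
      ∀ i, (e (Pi.single i 1) : V) = a i := by
  refine ⟨(Basis.span ha).equivFun.symm, fun i => ?_⟩
  rw [Basis.equivFun_symm_apply]
  simp [Pi.single_apply, Basis.span_apply]

lemma linearIndependent_of_dual {ι : Type*} [Fintype ι] [DecidableEq ι] {a b : ι → V}
    (h : ∀ i j, f (a i) (b j) = if i = j then 1 else 0) : LinearIndependent K b := by
  rw [Fintype.linearIndependent_iff]
  intro c hc i
  have := congrArg (f (a i)) hc
  simpa [h] using this

lemma linearIndependent_sumElim {ι : Type*} [Fintype ι] [DecidableEq ι] {u w : ι → V}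
    (huu : ∀ i j, f (u i) (u j) = 0) (hww : ∀ i j, f (w i) (w j) = 0)
    (huw : ∀ i j, f (u i) (w j) = if i = j then 1 else 0)
    (hwu : ∀ i j, f (w i) (u j) = if i = j then 1 else 0) :
    LinearIndependent K (Sum.elim u w) := by
  rw [Fintype.linearIndependent_iff]
  intro c hc
  rw [Fintype.sum_sum_type] at hc
  rintro (i | i)
  · simpa [hww, hwu] using congrArg (f (w i)) hc
  · simpa [huu, huw] using congrArg (f (u i)) hc

/-- Every matrix `A` such that `A + A^*` has rank at most one, of the form dictated by a vector
orthogonal to a hyperbolic frame, is realised by a closed path of length three. -/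
lemma exists_isProjectivity_three (hΔ : IsHermitianPolarSpace f r) {U : Submodule K V}
    (hU : IsSingular f U) (e : (Fin r → K) ≃ₗ[K] U) {w : Fin r → V}
    (hw : ∀ i j, f (w i) (w j) = 0)
    (huw : ∀ i j, f (e (Pi.single i 1)) (w j) = if i = j then 1 else 0)
    {v : V} (huv : ∀ i, f (e (Pi.single i 1)) v = 0) (hwv : ∀ i, f (w i) v = 0)
    {A : Matrix (Fin r) (Fin r) K} (hdet : A.det ≠ 0) {l : Fin r → K}
    (hA : ∀ i j, A i j + σ (A j i) + σ (l i) * l j * f v v = 0) :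
    ∃ φ, IsProjectivity f 3 U U φ ∧
      ∀ S, φ (S.map e.toLinearMap) = (polarMap σ A S).map e.toLinearMap := by
  set u : Fin r → V := fun i => e (Pi.single i 1) with hu
  have huu : ∀ i j, f (u i) (u j) = 0 := fun i j => hU _ (e _).2 _ (e _).2
  have huw' : ∀ i j, f (u i) (w j) = if i = j then 1 else 0 := huw
  have huv' : ∀ i, f (u i) v = 0 := huv
  have hwu : ∀ i j, f (w i) (u j) = if i = j then 1 else 0 := by
    intro i j
    rw [← hΔ.hermitian.eq, huw]
    split_ifs <;> simp_all
  have hvu : ∀ i, f v (u i) = 0 := fun i => hΔ.hermitian.isRefl _ _ (huv i)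
  have hvw : ∀ i, f v (w i) = 0 := fun i => hΔ.hermitian.isRefl _ _ (hwv i)
  -- The `x j` have Gram matrix `A` against `u` and the identity against `w`; the hypothesis on `A`
  -- says exactly that they span a singular subspace.
  set x : Fin r → V := fun j => u j + ∑ i, A i j • w i + l j • v with hx
  have hxx : ∀ i j, f (x i) (x j) = 0 := by
    intro i j
    simp [hx, huu, hw, huw', hwu, huv', hwv, hvu, hvw]
    linear_combination hA i j
  have hux : ∀ i j, f (u i) (x j) = A i j := by
    intro i j
    simp [hx, huu, huw', huv']
  have hwx : ∀ i j, f (w i) (x j) = if i = j then 1 else 0 := by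
    intro i j
    simp [hx, hwu, hw, hwv]
  have hxw : ∀ i j, f (x i) (w j) = if i = j then 1 else 0 := by
    intro i j
    rw [← hΔ.hermitian.eq, hwx]
    split_ifs <;> simp_all
  obtain ⟨eW, heW⟩ := exists_coordinates (linearIndependent_of_dual huw)
  obtain ⟨eX, heX⟩ := exists_coordinates (linearIndependent_of_dual hwx)
  have h1 : ∀ i j, f (e (Pi.single i 1)) (eX (Pi.single j 1)) = A i j := by
    intro i j; rw [heX]; exact hux i j
  have h2 : ∀ i j, f (eX (Pi.single i 1)) (eW (Pi.single j 1)) =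
      (1 : Matrix (Fin r) (Fin r) K) i j := by
    intro i j; rw [heX, heW, hxw, one_apply]
  have h3 : ∀ i j, f (eW (Pi.single i 1)) (e (Pi.single j 1)) =
      (1 : Matrix (Fin r) (Fin r) K) i j := by
    intro i j; rw [heW, one_apply]; exact hwu i j
  have hX := IsSingular.span hxx
  have hW := IsSingular.span hw
  have o1 := opposite_of_det_ne_zero hΔ.hermitian hU hX e eX h1 hdet
  have o2 := opposite_of_det_ne_zero hΔ.hermitian hX hW eX eW h2 (by simp)
  have o3 := opposite_of_det_ne_zero hΔ.hermitian hW hU eW e h3 (by simp)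
  refine ⟨_, (((IsProjectivity.refl U).step o1).step o2).step o3, fun S => ?_⟩
  simp only [Function.comp_apply, id_eq]
  -- The last two perspectivities both have Gram matrix `1` and cancel, which leaves the polar map
  -- of `A`.
  rw [perspectivity_map e eX h1, perspectivity_map eX eW h2, perspectivity_map eW e h3,
    polarMap_polarMap hΔ.involutive (M := 1) (by simp) (by ext i j; simp [one_apply, eq_comm]),
    matrixImage_of_scalar (a := 1) (by simp)]

/-! ### Compositions of an even number of perspectivities -/

lemma Opposite.eq_zero_of_forall {U W : Submodule K V}
    (h : Opposite f U W) {u : V} (hu : u ∈ U) (huW : ∀ w ∈ W, f w u = 0) : u = 0 := by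
  have : u ∈ U ⊓ W.orthogonalBilin f := ⟨hu, huW⟩
  rwa [h.disjoint, Submodule.mem_bot] at this

/-- Two subspaces opposite to the same subspace `W` are identified by their pairings with `W`. -/
lemma Opposite.exists_linearEquiv (hΔ : IsHermitianPolarSpace f r) {U W X : Submodule K V}
    (hUW : Opposite f U W) (hWX : Opposite f W X) :
    ∃ g : U ≃ₗ[K] X, (∀ u, ∀ w ∈ W, f w (g u) = f w u) ∧
      ∀ S, perspectivity f W X (perspectivity f U W S) = S.map g.toLinearMap := by
  have := hUW.finite_right
  let b := finBasis K W
  have key : ∀ {Y : Submodule K V}, Opposite f Y W →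
      ∃ R : Y ≃ₗ[K] (Fin (finrank K W) → K), ∀ y i, R y i = f (b i) y := by
    intro Y hY
    have := hY.finite_left
    let T : Y →ₗ[K] Fin (finrank K W) → K :=
      LinearMap.pi fun i => (f (b i)).comp Y.subtype
    have hT : Function.Injective T := by
      rw [injective_iff_map_eq_zero]
      intro y hy
      refine Subtype.ext (hY.eq_zero_of_forall y.2 fun w hw => ?_)
      have h1 : ∀ i, f (b i) y = 0 := fun i => congrFun hy i
      have h2 : w = ∑ i, b.repr ⟨w, hw⟩ i • (b i : V) := by
        have := congrArg W.subtype (b.sum_repr ⟨w, hw⟩)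
        rw [map_sum] at this
        exact this.symm
      rw [h2]
      simp [h1]
    exact ⟨LinearEquiv.ofInjectiveOfFinrankEq T hT (by rw [hY.finrank_eq, finrank_fin_fun]),
      fun y i => rfl⟩
  obtain ⟨R, hR⟩ := key hUW
  obtain ⟨R', hR'⟩ := key (hWX.symm hΔ)
  have hg : ∀ u, ∀ w ∈ W, f w ((R.trans R'.symm) u) = f w u := by
    intro u w hw
    have h1 : ∀ i, f (b i) ((R.trans R'.symm) u) = f (b i) u := by
      intro i
      rw [← hR, ← hR', LinearEquiv.trans_apply, LinearEquiv.apply_symm_apply]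
    have h2 : w = ∑ i, b.repr ⟨w, hw⟩ i • (b i : V) := by
      have := congrArg W.subtype (b.sum_repr ⟨w, hw⟩)
      rw [map_sum] at this
      exact this.symm
    rw [h2]
    simp only [map_sum, LinearMap.sum_apply, map_smulₛₗ, LinearMap.smul_apply, h1]
  refine ⟨R.trans R'.symm, hg, fun S => ?_⟩
  ext x
  obtain ⟨u, rfl⟩ := (R.trans R'.symm).surjective x
  have h1 : u ∈ S ↔ ∀ w ∈ perspectivity f U W S, f (w : V) u = 0 := by
    rw [← mem_perspectivity]
    exact (congrArg (u ∈ ·) (congrFun (hUW.perspectivity_comp hΔ) S)).symm.to_iff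
  rw [mem_perspectivity]
  constructor
  · intro h
    exact ⟨u, h1.2 fun w hw => (hg u w w.2).symm.trans (h w hw), rfl⟩
  · rintro ⟨u', hu', h⟩ w hw
    obtain rfl := (R.trans R'.symm).injective h
    exact (hg u' w w.2).trans (h1.1 hu' w hw)

/-- If `V = U ⊕ W`, the identification of two subspaces `U` and `X` opposite to `W` extends to a
unipotent isometry of `V`. -/
lemma Opposite.exists_isometry (hΔ : IsHermitianPolarSpace f r) [FiniteDimensional K V]
    {U W X : Submodule K V} (hUW : Opposite f U W) (hWX : Opposite f W X)
    (hdim : finrank K V = 2 * finrank K U) (g : U ≃ₗ[K] X)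
    (hg : ∀ u, ∀ w ∈ W, f w (g u) = f w u) :
    ∃ h : V →ₗ[K] V, (∀ x y, f (h x) (h y) = f x y) ∧ LinearMap.det h = 1 ∧
      ∀ u : U, h u = g u := by
  have hdisj : Disjoint U W := by
    rw [disjoint_iff, eq_bot_iff]
    rintro x ⟨hxU, hxW⟩
    exact hUW.eq_zero_of_forall hxU fun w hw => hUW.right w hw x hxW
  have hcompl : IsCompl U W := by
    refine ⟨hdisj, codisjoint_iff.2 (Submodule.eq_top_of_disjoint U W ?_ hdisj)⟩
    rw [hdim, ← hUW.finrank_eq, two_mul]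
  have hsum : ∀ x : V, ∃ u : U, ∃ w : W, (u : V) + w = x := by
    intro x
    obtain ⟨u, hu, w, hw, h⟩ := Submodule.mem_sup.1
      (hcompl.sup_eq_top.symm ▸ Submodule.mem_top : x ∈ U ⊔ W)
    exact ⟨⟨u, hu⟩, ⟨w, hw⟩, h⟩
  -- The difference is orthogonal to `W`, so its component in `U` vanishes by opposition.
  have hsub : ∀ u : U, (g u : V) - u ∈ W := by
    intro u
    obtain ⟨a, b, hab⟩ := hsum ((g u : V) - u)
    have : (a : V) = 0 := by
      refine hUW.eq_zero_of_forall a.2 fun w hw => ?_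
      have h1 : f w ((g u : V) - u) = 0 := by rw [map_sub, hg u w hw, sub_self]
      rwa [← hab, map_add, hUW.right w hw b b.2, add_zero] at h1
    rw [← hab, this, zero_add]
    exact b.2
  -- Take `g` on `U` and the identity on `W`. By `hsub` this is also trivial on `V / W`, whence
  -- determinant one.
  let h : V →ₗ[K] V := LinearMap.ofIsCompl hcompl (X.subtype.comp g.toLinearMap) W.subtype
  have hhU : ∀ u : U, h u = g u := fun u => by simp [h]
  have hhW : ∀ w : W, h w = w := fun w => by simp [h]
  refine ⟨h, fun x y => ?_, ?_, hhU⟩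
  · obtain ⟨u, w, rfl⟩ := hsum x
    obtain ⟨u', w', rfl⟩ := hsum y
    have h1 : f (g u) w' = f u w' := by
      rw [← hΔ.hermitian.eq, hg u w' w'.2, hΔ.hermitian.eq]
    simp only [map_add, hhU, hhW, LinearMap.add_apply]
    rw [hWX.right _ (g u).2 _ (g u').2, hUW.left _ u.2 _ u'.2, hg u' w w.2, h1]
  · have hW : W ≤ W.comap h := fun w hw => by
      rw [Submodule.mem_comap, hhW ⟨w, hw⟩]; exact hw
    rw [LinearMap.det_eq_det_mul_det W h hW]
    have h1 : h.restrict hW = LinearMap.id := by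
      ext w
      exact hhW w
    have h2 : W.mapQ W h hW = LinearMap.id := by
      ext x
      obtain ⟨u, w, rfl⟩ := hsum x
      simp only [LinearMap.comp_apply, Submodule.mkQ_apply, Submodule.mapQ_apply,
        LinearMap.id_apply]
      rw [Submodule.Quotient.eq, map_add, hhU, hhW, add_sub_add_right_eq_sub]
      exact hsub u
    rw [h1, h2, LinearMap.det_id, LinearMap.det_id, one_mul]

/-- Perspectivities are grouped in pairs. The determinant of `g` has no meaning while `U` and `W`
differ, so the induction carries an isometry of all of `V` with determinant one. -/
lemma IsProjectivity.exists_linearEquiv (hΔ : IsHermitianPolarSpace f r) {n : ℕ}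
    {U W : Submodule K V} {φ : Submodule K U → Submodule K W} (h : IsProjectivity f n U W φ)
    (hn : Even n) :
    ∃ g : U ≃ₗ[K] W, (∀ S, φ S = S.map g.toLinearMap) ∧
      (FiniteDimensional K V → finrank K V = 2 * finrank K U →
        ∃ h : V →ₗ[K] V, (∀ x y, f (h x) (h y) = f x y) ∧ LinearMap.det h = 1 ∧
          ∀ u : U, h u = g u) := by
  obtain ⟨m, rfl⟩ := hn
  induction m generalizing W φ with
  | zero =>
    cases h
    exact ⟨.refl K U, fun S => by simp, fun _ _ => ⟨LinearMap.id, by simp, by simp, by simp⟩⟩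
  | succ m ih =>
    rw [show m + 1 + (m + 1) = m + m + 1 + 1 by ring] at h
    cases h with
    | @step _ _ Y _ _ h hYW =>
      cases h with
      | @step _ _ X _ ψ h hXY =>
        obtain ⟨g, hg, hgV⟩ := ih h
        obtain ⟨g', hg', hgS⟩ := hXY.exists_linearEquiv hΔ hYW
        refine ⟨g.trans g', fun S => ?_, fun hV hdim => ?_⟩
        · simp only [Function.comp_apply]
          rw [hgS, hg, ← Submodule.map_comp]
          rfl
        · obtain ⟨h₁, hh₁, hd₁, hu₁⟩ := hgV hV hdim
          obtain ⟨h₂, hh₂, hd₂, hu₂⟩ :=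
            hXY.exists_isometry hΔ hYW (by rw [hdim, g.finrank_eq]) g' hg'
          refine ⟨h₂.comp h₁, fun x y => by simp [hh₁, hh₂], ?_, fun u => by simp [hu₁, hu₂]⟩
          rw [LinearMap.det_comp, hd₁, hd₂, one_mul]

/-- An isometry of determinant one which stabilises a maximal singular subspace of a hyperbolic
space acts on it with a determinant fixed by the involution. -/
lemma apply_det_eq_of_isometry (hΔ : IsHermitianPolarSpace f r) [FiniteDimensional K V]
    (hdim : finrank K V = 2 * r) {U : Submodule K V} (hU : IsSingular f U)
    (e : (Fin r → K) ≃ₗ[K] U) {w : Fin r → V} (hw : ∀ i j, f (w i) (w j) = 0)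
    (huw : ∀ i j, f (e (Pi.single i 1)) (w j) = if i = j then 1 else 0)
    {h : V →ₗ[K] V} (hh : ∀ x y, f (h x) (h y) = f x y) (hd : LinearMap.det h = 1)
    {M : Matrix (Fin r) (Fin r) K} (hM : ∀ s, h (e s) = e (M *ᵥ s)) : σ M.det = M.det := by
  set u : Fin r → V := fun i => e (Pi.single i 1) with hu
  have huu : ∀ i j, f (u i) (u j) = 0 := fun i j => hU _ (e _).2 _ (e _).2
  have huw' : ∀ i j, f (u i) (w j) = if i = j then 1 else 0 := huw
  have hwu : ∀ i j, f (w i) (u j) = if i = j then 1 else 0 := by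
    intro i j
    rw [← hΔ.hermitian.eq, huw']
    split_ifs <;> simp_all
  have hMu : ∀ j, h (u j) = ∑ i, M i j • u i := by
    intro j
    rw [hu, hM]
    have : M *ᵥ Pi.single j 1 = ∑ i, M i j • (Pi.single i 1 : Fin r → K) := by
      ext k
      simp [Pi.single_apply, Finset.sum_apply]
    rw [this, map_sum]
    simp
  have hli := linearIndependent_sumElim huu hw huw' hwu
  let b : Basis (Fin r ⊕ Fin r) K V :=
    basisOfLinearIndependentOfCardEqFinrank' _ hli (by simp [hdim, two_mul])
  have hbl : ∀ i, b (.inl i) = u i := fun i => by simp [b]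
  have hbr : ∀ i, b (.inr i) = w i := fun i => by simp [b]
  have hcl : ∀ i, f (w i) = b.coord (.inl i) := by
    intro i
    refine b.ext ?_
    rintro (j | j)
    · rw [hbl, hwu, ← hbl, Basis.coord_apply, Basis.repr_self]
      simp [Finsupp.single_apply, eq_comm]
    · rw [hbr, hw, ← hbr, Basis.coord_apply, Basis.repr_self]
      simp
  have hcr : ∀ i, f (u i) = b.coord (.inr i) := by
    intro i
    refine b.ext ?_
    rintro (j | j)
    · rw [hbl, huu, ← hbl, Basis.coord_apply, Basis.repr_self]
      simp
    · rw [hbr, huw', ← hbr, Basis.coord_apply, Basis.repr_self]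
      simp [Finsupp.single_apply, eq_comm]
  set B : Matrix (Fin r) (Fin r) K := of fun i j => f (w i) (h (w j))
  set Q : Matrix (Fin r) (Fin r) K := of fun i j => f (u i) (h (w j)) with hQ
  -- The lower left block vanishes because `h` stabilises `U`.
  have hmat : LinearMap.toMatrix b b h = fromBlocks M B 0 Q := by
    ext i j
    rw [LinearMap.toMatrix_apply, ← Basis.coord_apply]
    rcases i with i | i <;> rcases j with j | j
    · rw [← hcl, hbl, hMu]
      simp [hwu]
    · rw [← hcl, hbr]
      rfl
    · rw [← hcr, hbl, hMu]
      simp [huu]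
    · rw [← hcr, hbr]
      rfl
  rw [← LinearMap.det_toMatrix b, hmat, det_fromBlocks_zero₂₁] at hd
  -- Invariance of the pairing between `u` and `w`; together with `det M * det Q = 1` it gives the
  -- claim.
  have hPQ : conjTransposeBy σ M * Q = 1 := by
    ext i j
    have h1 := hh (u i) (w j)
    rw [huw', hMu] at h1
    rw [one_apply, ← h1, mul_apply]
    simp [hQ]
  have hdet := congrArg det hPQ
  rw [det_mul, det_conjTransposeBy, det_one] at hdet
  have hQ0 : Q.det ≠ 0 := right_ne_zero_of_mul (hd.trans_ne one_ne_zero)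
  exact mul_right_cancel₀ hQ0 (hdet.trans hd.symm)

/-! ### The anisotropic part -/

lemma apply_swap_eq_ite (hf : f.IsSymm) {ι : Type*} [DecidableEq ι] {u w : ι → V}
    (huw : ∀ i j, f (u i) (w j) = if i = j then 1 else 0) (i j : ι) :
    f (w i) (u j) = if i = j then 1 else 0 := by
  rw [← hf.eq, huw]
  split_ifs <;> simp_all

/-- A hyperbolic basis of `V` has `2 * n` vectors, with `n ≤ r` because half of it spans a singular
subspace; the given frame supplies `2 * r` independent vectors. -/
lemma HasTrivialAnisotropicPart.finrank_eq (hΔ : IsHermitianPolarSpace f r)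
    (h : HasTrivialAnisotropicPart f) {u w : Fin r → V} (huu : ∀ i j, f (u i) (u j) = 0)
    (hww : ∀ i j, f (w i) (w j) = 0) (huw : ∀ i j, f (u i) (w j) = if i = j then 1 else 0) :
    FiniteDimensional K V ∧ finrank K V = 2 * r := by
  obtain ⟨n, a, a', haa, -, haa', -, hcompl, -⟩ := h
  have htop : Submodule.span K (Set.range a ∪ Set.range a') = ⊤ := by
    simpa using hcompl.sup_eq_top
  rw [← Set.Sum.elim_range] at htop
  have hfin : FiniteDimensional K V := by
    exact ⟨htop ▸ Submodule.fg_span (Set.finite_range _)⟩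
  have hn : n ≤ r := by
    have h1 := hΔ.rank_le _ (IsSingular.span haa)
    have h2 := rank_eq_card_basis (Basis.span
      (linearIndependent_of_dual (apply_swap_eq_ite hΔ.hermitian haa')))
    rw [h2, Fintype.card_fin] at h1
    exact_mod_cast h1
  have h1 : finrank K V ≤ n + n := by
    rw [← finrank_top, ← htop]
    exact (finrank_range_le_card _).trans (by simp)
  have h2 := (linearIndependent_sumElim huu hww huw
    (apply_swap_eq_ite hΔ.hermitian huw)).fintype_card_le_finrank
  simp only [Fintype.card_sum, Fintype.card_fin] at h2
  exact ⟨hfin, by omega⟩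

/-- If every vector orthogonal to the frame were isotropic, it would lie in `U` by maximality and
then vanish by its pairing with `w`. The frame would span `V`. -/
lemma exists_anisotropic_of_not_trivial (hΔ : IsHermitianPolarSpace f r)
    (h : ¬ HasTrivialAnisotropicPart f) {U : Submodule K V} (hU : Maximal (IsSingular f) U)
    (e : (Fin r → K) ≃ₗ[K] U) {w : Fin r → V} (hww : ∀ i j, f (w i) (w j) = 0)
    (huw : ∀ i j, f (e (Pi.single i 1)) (w j) = if i = j then 1 else 0) :
    ∃ v : V, (∀ i, f (e (Pi.single i 1)) v = 0) ∧ (∀ i, f (w i) v = 0) ∧ f v v ≠ 0 := by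
  by_contra! hv
  refine h ?_
  set u : Fin r → V := fun i => e (Pi.single i 1) with hu
  have huu : ∀ i j, f (u i) (u j) = 0 := fun i j => hU.1 _ (e _).2 _ (e _).2
  have huw' : ∀ i j, f (u i) (w j) = if i = j then 1 else 0 := huw
  have hwu := apply_swap_eq_ite hΔ.hermitian huw'
  have hexp : ∀ s, (e s : V) = ∑ i, s i • u i := by
    intro s
    have : s = ∑ i, s i • (Pi.single i 1 : Fin r → K) := by
      ext k
      simp [Pi.single_apply, Finset.sum_apply]
    conv_lhs => rw [this, map_sum]
    simp [hu]
  have hzero : ∀ v, (∀ i, f (u i) v = 0) → (∀ i, f (w i) v = 0) → v = 0 := by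
    intro v h1 h2
    have h3 : v ∈ U := by
      refine mem_of_maximal hΔ.hermitian hU (hv v h1 h2) fun x hx => ?_
      obtain ⟨s, hs⟩ := e.surjective ⟨x, hx⟩
      rw [show x = e s from (congrArg Subtype.val hs).symm, hexp]
      simp [h1]
    obtain ⟨s, hs⟩ := e.surjective ⟨v, h3⟩
    have h4 : v = e s := (congrArg Subtype.val hs).symm
    have h5 : s = 0 := by
      ext i
      have := h2 i
      rw [h4, hexp] at this
      simpa [hwu] using this
    rw [h4, h5, map_zero]
    rfl
  refine ⟨r, u, w, huu, hww, huw', bot_le, ?_, fun v hv _ => (Submodule.mem_bot K).1 hv⟩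
  suffices Submodule.span K (Set.range u ∪ Set.range w) = ⊤ by
    rw [this]; exact isCompl_top_bot
  rw [eq_top_iff]
  rintro x -
  have hx := hzero (x - (∑ i, f (w i) x • u i + ∑ i, f (u i) x • w i))
    (fun i => by simp [huu, huw']) (fun i => by simp [hww, hwu])
  rw [sub_eq_zero.1 hx]
  exact add_mem
    (sum_mem fun i _ => Submodule.smul_mem _ _ (Submodule.subset_span (.inl ⟨i, rfl⟩)))
    (sum_mem fun i _ => Submodule.smul_mem _ _ (Submodule.subset_span (.inr ⟨i, rfl⟩)))

/-! ### The action of invertible matrices on subspaces -/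

lemma matrixImage_mul (M N : GL (Fin r) K) (S : Submodule K (Fin r → K)) :
    matrixImage (M * N) S = matrixImage M (matrixImage N S) := by
  rw [matrixImage, matrixImage, matrixImage, ← Submodule.map_comp, Units.val_mul,
    mulVecLin_mul]

/-- The action of invertible matrices on the subspaces of a vector space with coordinates `e`. -/
def projAction {U : Type*} [AddCommGroup U] [Module K U] (e : (Fin r → K) ≃ₗ[K] U) :
    GL (Fin r) K →* Equiv.Perm (Submodule K U) :=
  (Submodule.orderIsoMapComap e).toEquiv.permCongrHom.toMonoidHom.comp <|
    MonoidHom.toHomPerm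
      { toFun := fun M => (matrixImage M : Function.End (Submodule K (Fin r → K)))
        map_one' := funext fun S => matrixImage_of_scalar (a := 1) (by simp) S
        map_mul' := fun M N => funext fun S => matrixImage_mul M N S }

section projAction

variable {U : Type*} [AddCommGroup U] [Module K U] (e : (Fin r → K) ≃ₗ[K] U)

lemma exists_map_eq (T : Submodule K U) : ∃ S : Submodule K (Fin r → K),
    S.map e.toLinearMap = T :=
  ⟨T.comap e.toLinearMap, Submodule.map_comap_eq_of_surjective e.surjective T⟩

lemma projAction_apply (M : GL (Fin r) K) (S : Submodule K (Fin r → K)) :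
    projAction e M (S.map e.toLinearMap) = (matrixImage M S).map e.toLinearMap := by
  have h : (Submodule.orderIsoMapComap e).toEquiv.symm (S.map e.toLinearMap) = S :=
    (Submodule.orderIsoMapComap e).symm_apply_apply S
  change (Submodule.orderIsoMapComap e).toEquiv (matrixImage M
    ((Submodule.orderIsoMapComap e).toEquiv.symm (S.map e.toLinearMap))) = _
  rw [h]
  rfl

lemma perm_eq_projAction {g : Equiv.Perm (Submodule K U)} {M : GL (Fin r) K}
    (h : ∀ S : Submodule K (Fin r → K),
      g (S.map e.toLinearMap) = (matrixImage M S).map e.toLinearMap) : g = projAction e M := by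
  ext1 T
  obtain ⟨S, rfl⟩ := exists_map_eq e T
  rw [h, projAction_apply]

lemma projAction_eq_one_iff (M : GL (Fin r) K) :
    projAction e M = 1 ↔ ∃ a : K, (M : Matrix (Fin r) (Fin r) K) = scalar (Fin r) a := by
  constructor
  · intro h
    refine exists_scalar_of_matrixImage_eq fun S => ?_
    refine Submodule.map_injective_of_injective (f := e.toLinearMap) e.injective ?_
    rw [← projAction_apply, h, Equiv.Perm.one_apply]
  · rintro ⟨a, ha⟩
    ext1 T
    obtain ⟨S, rfl⟩ := exists_map_eq e T
    rw [projAction_apply, matrixImage_of_scalar ha, Equiv.Perm.one_apply]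

lemma projAction_ker : (projAction e).ker = Subgroup.center (GL (Fin r) K) := by
  ext M
  rw [MonoidHom.mem_ker, projAction_eq_one_iff,
    GeneralLinearGroup.mem_center_iff_val_mem_range_scalar]
  exact exists_congr fun a => eq_comm

/-- All transvections lie in `SLOver r F`, so its central elements are scalar. -/
lemma projAction_slOver_ker (F : Subfield K) :
    ((projAction e).comp (SLOver r F).subtype).ker = Subgroup.center (SLOver r F) := by
  ext M
  rw [MonoidHom.mem_ker, MonoidHom.comp_apply, projAction_eq_one_iff, Subgroup.mem_center_iff]
  constructor
  · rintro ⟨a, ha⟩ N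
    refine Subtype.ext (Units.ext ?_)
    change ((N : GL (Fin r) K) : Matrix (Fin r) (Fin r) K) * _ = _ * _
    rw [show ((M : GL (Fin r) K) : Matrix (Fin r) (Fin r) K) = scalar (Fin r) a from ha]
    exact ((scalar_commute a (fun b => Commute.all a b) _).eq).symm
  · intro h
    obtain ⟨a, ha⟩ := mem_range_scalar_of_commute_transvectionStruct
      (M := ((M : GL (Fin r) K) : Matrix (Fin r) (Fin r) K)) (by
        intro t
        let T : SLOver r F := ⟨⟨t.toMatrix, t.inv.toMatrix, t.mul_inv, t.inv_mul⟩, by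
          change t.toMatrix.det ∈ F
          rw [TransvectionStruct.det]
          exact F.one_mem⟩
        exact congrArg (fun N : SLOver r F => ((N : GL (Fin r) K) : Matrix (Fin r) (Fin r) K))
          (h T))
    exact ⟨a, ha.symm⟩

/-! ### Polarities in coordinates. -/

lemma orthogonalBilin_map {B : U →ₛₗ[σ] U →ₗ[K] K} {A : Matrix (Fin r) (Fin r) K}
    (hB : ∀ s t, B (e s) (e t) = (σ ∘ s) ⬝ᵥ A *ᵥ t) (S : Submodule K (Fin r → K)) :
    (S.map e.toLinearMap).orthogonalBilin B = (polarMap σ A S).map e.toLinearMap := by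
  ext y
  obtain ⟨t, rfl⟩ := e.surjective y
  constructor
  · intro h
    exact ⟨t, fun s hs => (hB s t).symm.trans (h _ ⟨s, hs, rfl⟩), rfl⟩
  · rintro ⟨t', ht', h⟩ _ ⟨s, hs, rfl⟩
    obtain rfl := e.injective h
    exact (hB s t').trans (ht' s hs)

/-- A polarity is given by a skew-Hermitian matrix. -/
lemma IsPolarity.exists_skewHermitian (hσ : ∀ a, σ (σ a) = a) (hσ' : σ ≠ RingHom.id K)
    {ρ : Equiv.Perm (Submodule K U)} (h : IsPolarity σ ρ) :
    ∃ A : Matrix (Fin r) (Fin r) K, A.det ≠ 0 ∧ conjTransposeBy σ A = -A ∧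
      ∀ S, ρ (S.map e.toLinearMap) = (polarMap σ A S).map e.toLinearMap := by
  obtain ⟨B, hrefl, hnd, hρ⟩ := h
  set A : Matrix (Fin r) (Fin r) K := of fun i j => B (e (Pi.single i 1)) (e (Pi.single j 1))
    with hA
  have hB : ∀ s t, B (e s) (e t) = (σ ∘ s) ⬝ᵥ A *ᵥ t := by
    have h1 : ∀ s, e s = ∑ i, s i • e (Pi.single i 1) := by
      intro s
      have : s = ∑ i, s i • (Pi.single i 1 : Fin r → K) := by
        ext k
        simp [Pi.single_apply, Finset.sum_apply]
      conv_lhs => rw [this, map_sum]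
      simp
    intro s t
    rw [h1 s, h1 t]
    simp only [map_sum, LinearMap.sum_apply, map_smulₛₗ, LinearMap.smul_apply, hA, dotProduct,
      mulVec, smul_eq_mul, Finset.mul_sum, Function.comp_apply, RingHom.id_apply, of_apply]
    rw [Finset.sum_comm]
    refine Finset.sum_congr rfl fun i _ => Finset.sum_congr rfl fun j _ => by ring
  have hdet : A.det ≠ 0 := by
    intro h0
    obtain ⟨t, ht, hAt⟩ := exists_mulVec_eq_zero_iff.2 h0
    refine ht (e.map_eq_zero_iff.1 (hnd.2 _ fun x => ?_))
    obtain ⟨s, rfl⟩ := e.surjective x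
    rw [hB, hAt, dotProduct_zero]
  have hAρ : ∀ S, ρ (S.map e.toLinearMap) = (polarMap σ A S).map e.toLinearMap := fun S => by
    rw [hρ, orthogonalBilin_map e hB]
  obtain ⟨c, hc, hcA⟩ := exists_smul_skewHermitian hσ hσ' hdet
    (fun x y hxy => by rw [← hB] at hxy ⊢; exact hrefl _ _ hxy)
  refine ⟨c • A, ?_, hcA, fun S => by rw [polarMap_smul hc, hAρ]⟩
  rw [det_smul]
  exact mul_ne_zero (pow_ne_zero _ hc) hdet

/-- Here `A⁻¹ A^* = -1` is scalar and fixes all subspaces. -/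
lemma polarMap_involutive_of_skewHermitian (hσ : ∀ a, σ (σ a) = a)
    {A : Matrix (Fin r) (Fin r) K} (hA : A.det ≠ 0) (hA' : conjTransposeBy σ A = -A)
    (S : Submodule K (Fin r → K)) : polarMap σ A (polarMap σ A S) = S := by
  rw [polarMap_polarMap hσ hA (M := -1) (by rw [hA']; simp),
    matrixImage_of_scalar (a := -1) (by simp [← diagonal_one])]

/-- The standard form `∑ σ (x i) * y i` works; its orthogonal map is its own inverse. -/
lemma exists_isPolarity (e : (Fin r → K) ≃ₗ[K] U) (hσ : ∀ a, σ (σ a) = a) :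
    ∃ ρ : Equiv.Perm (Submodule K U), IsPolarity σ ρ := by
  have hdot : ∀ x y : Fin r → K, σ ((σ ∘ x) ⬝ᵥ y) = (σ ∘ y) ⬝ᵥ x := by
    intro x y
    simp [dotProduct, map_sum, hσ, mul_comm]
  let B : U →ₛₗ[σ] U →ₗ[K] K := LinearMap.mk₂'ₛₗ σ (RingHom.id K)
    (fun x y => (σ ∘ e.symm x) ⬝ᵥ e.symm y)
    (fun x x' y => by simp [dotProduct, add_mul, Finset.sum_add_distrib])
    (fun c x y => by simp [dotProduct, Finset.mul_sum, mul_assoc])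
    (fun x y y' => by simp [dotProduct_add])
    (fun c x y => by simp)
  have hB : ∀ x y, B x y = (σ ∘ e.symm x) ⬝ᵥ e.symm y := fun x y => rfl
  have hrefl : B.IsRefl := by
    intro x y hxy
    rw [hB] at hxy ⊢
    rw [← hdot, hxy, map_zero]
  have hright : ∀ y, (∀ x, B x y = 0) → y = 0 := by
    intro y h
    refine e.symm.map_eq_zero_iff.1 (funext fun i => ?_)
    have := h (e (Pi.single i 1))
    rw [hB, e.symm_apply_apply] at this
    simpa [dotProduct, Pi.single_apply, apply_ite σ] using this
  have hinv : ∀ S : Submodule K U, (S.orthogonalBilin B).orthogonalBilin B = S := by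
    intro T
    obtain ⟨S, rfl⟩ := exists_map_eq e T
    have hB' : ∀ s t, B (e s) (e t) = (σ ∘ s) ⬝ᵥ (1 : Matrix (Fin r) (Fin r) K) *ᵥ t := by
      intro s t
      rw [hB, e.symm_apply_apply, e.symm_apply_apply, one_mulVec]
    rw [orthogonalBilin_map e hB', orthogonalBilin_map e hB',
      polarMap_polarMap hσ (M := 1) (by simp) (by ext i j; simp [one_apply, eq_comm]),
      matrixImage_of_scalar (a := 1) (by simp)]
  exact ⟨⟨fun S => S.orthogonalBilin B, fun S => S.orthogonalBilin B, hinv, hinv⟩, B, hrefl,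
    ⟨fun x h => hright x fun y => hrefl _ _ (h y), hright⟩, fun S => rfl⟩

end projAction

/-! ### The projectivity groups -/

lemma exists_hyperbolic_frame (hΔ : IsHermitianPolarSpace f r) {U : Submodule K V}
    (hU : IsSingular f U) (e : (Fin r → K) ≃ₗ[K] U) :
    ∃ w : Fin r → V, (∀ i j, f (w i) (w j) = 0) ∧
      ∀ i j, f (e (Pi.single i 1)) (w j) = if i = j then 1 else 0 := by
  refine exists_hyperbolic_family hΔ (u := fun i => (e (Pi.single i 1) : V)) ?_
    fun i j => hU _ (e _).2 _ (e _).2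
  have h1 := (Pi.basisFun K (Fin r)).linearIndependent.map' (U.subtype.comp e.toLinearMap) (by
    rw [LinearMap.ker_eq_bot]
    exact U.injective_subtype.comp e.injective)
  have h2 : (U.subtype.comp e.toLinearMap) ∘ (Pi.basisFun K (Fin r)) =
      fun i => (e (Pi.single i 1) : V) := by
    ext i
    simp
  rwa [h2] at h1

/-- Every polarity is the composition of three perspectivities. -/
lemma IsPolarity.isProjectivity (hΔ : IsHermitianPolarSpace f r) {U : Submodule K V}
    (hU : IsSingular f U) (e : (Fin r → K) ≃ₗ[K] U) {ρ : Equiv.Perm (Submodule K U)}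
    (hρ : IsPolarity σ ρ) : IsProjectivity f 3 U U ρ := by
  obtain ⟨w, hw, huw⟩ := exists_hyperbolic_frame hΔ hU e
  obtain ⟨A, hA, hAs, hAρ⟩ := hρ.exists_skewHermitian e hΔ.involutive hΔ.nontrivial
  obtain ⟨φ, hφ, hφA⟩ := exists_isProjectivity_three hΔ hU e hw huw (v := 0) (by simp) (by simp)
    hA (l := 0) (fun i j => by
      have := congrFun₂ hAs i j
      rw [conjTransposeBy_apply, Matrix.neg_apply] at this
      simp [this])
  convert hφ using 1
  ext1 T
  obtain ⟨S, rfl⟩ := exists_map_eq e T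
  rw [hφA, hAρ]

lemma IsPolarity.mul_self (hσ : ∀ a, σ (σ a) = a) (hσ' : σ ≠ RingHom.id K)
    {U : Type*} [AddCommGroup U] [Module K U] (e : (Fin r → K) ≃ₗ[K] U)
    {ρ : Equiv.Perm (Submodule K U)} (hρ : IsPolarity σ ρ) : ρ * ρ = 1 := by
  obtain ⟨A, hA, hAs, hAρ⟩ := hρ.exists_skewHermitian e hσ hσ'
  ext1 T
  obtain ⟨S, rfl⟩ := exists_map_eq e T
  rw [Equiv.Perm.mul_apply, hAρ, hAρ, polarMap_involutive_of_skewHermitian hσ hA hAs,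
    Equiv.Perm.one_apply]

/-- An even projectivity is induced by a linear map and fixes `⊤`, whereas a polarity sends `⊤` to
`⊥`; these differ since `r ≥ 1`. -/
lemma IsPolarity.notMem_specialProjectivityGroup (hr : 1 ≤ r) (hΔ : IsHermitianPolarSpace f r)
    {U : Submodule K V} (e : (Fin r → K) ≃ₗ[K] U) {ρ : Equiv.Perm (Submodule K U)}
    (hρ : IsPolarity σ ρ) : ρ ∉ specialProjectivityGroup hΔ U := by
  rintro ⟨n, hn, h⟩
  obtain ⟨g, hg, -⟩ := h.exists_linearEquiv hΔ hn
  obtain ⟨B, -, hnd, hB⟩ := hρ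
  have h1 : ρ ⊤ = ⊤ := by
    rw [hg, Submodule.map_top, LinearEquiv.range]
  have h2 : ρ ⊤ = ⊥ := by
    rw [hB, eq_bot_iff]
    intro y hy
    exact (Submodule.mem_bot K).2 (hnd.2 y fun x => hy x trivial)
  have : Nonempty (Fin r) := ⟨⟨0, hr⟩⟩
  have : Nontrivial U := e.symm.toEquiv.nontrivial
  exact bot_ne_top (h2.symm.trans h1)

lemma specialProjectivityGroup_le (hΔ : IsHermitianPolarSpace f r) (U : Submodule K V) :
    specialProjectivityGroup hΔ U ≤ generalProjectivityGroup hΔ U :=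
  fun _ ⟨n, _, h⟩ => ⟨n, h⟩

/-- The general projectivity group is the semidirect product of the special one with the group
generated by any polarity. -/
lemma exists_generalProjectivityGroup_mulEquiv (hr : 1 ≤ r) (hΔ : IsHermitianPolarSpace f r)
    {U : Submodule K V} (hU : IsSingular f U) (e : (Fin r → K) ≃ₗ[K] U) {Q : Type*} [Group Q]
    (Φ : Q ≃* specialProjectivityGroup hΔ U) {ρ : Equiv.Perm (Submodule K U)}
    (hρ : IsPolarity σ ρ) :
    ∃ (α : Subgroup.zpowers ρ →* MulAut Q)
      (Ψ : Q ⋊[α] Subgroup.zpowers ρ ≃* generalProjectivityGroup hΔ U),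
      (∀ q, (Ψ (SemidirectProduct.inl q) : Equiv.Perm (Submodule K U)) = Φ q) ∧
        ∀ h : Subgroup.zpowers ρ,
          (Ψ (SemidirectProduct.inr h) : Equiv.Perm (Submodule K U)) = h := by
  have h3 := hρ.isProjectivity hΔ hU e
  refine exists_semidirectProduct_mulEquiv (specialProjectivityGroup_le hΔ U) Φ ⟨3, h3⟩
    (hρ.notMem_specialProjectivityGroup hr hΔ e)
    (hρ.mul_self hΔ.involutive hΔ.nontrivial e) ?_ ?_
  · rintro g ⟨n, hn⟩
    rcases Nat.even_or_odd n with h | h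
    · exact .inl ⟨n, h, hn⟩
    -- Composing with `ρ`, a path of length three, switches parity.
    · exact .inr ⟨3 + n, (by decide : Odd 3).add_odd h, h3.trans hn⟩
  · rintro g ⟨n, hn, hg⟩
    exact ⟨3 + (n + 3), by rw [show 3 + (n + 3) = n + 6 by omega]; exact hn.add (by decide),
      (h3.perm_inv hΔ).trans (hg.trans h3)⟩

/-- Two closed paths of length three compose to the action of `A₂⁻¹ A₁^*`; it remains to choose `A₁`
and `A₂` for a prescribed `M`. -/
lemma projAction_mem_specialProjectivityGroup (hΔ : IsHermitianPolarSpace f r)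
    {U : Submodule K V} (hU : IsSingular f U) (e : (Fin r → K) ≃ₗ[K] U) {w : Fin r → V}
    (hw : ∀ i j, f (w i) (w j) = 0)
    (huw : ∀ i j, f (e (Pi.single i 1)) (w j) = if i = j then 1 else 0)
    {v : V} (huv : ∀ i, f (e (Pi.single i 1)) v = 0) (hwv : ∀ i, f (w i) v = 0)
    {A₁ A₂ : Matrix (Fin r) (Fin r) K} (hdet₁ : A₁.det ≠ 0) (hdet₂ : A₂.det ≠ 0)
    {l₁ l₂ : Fin r → K} (hA₁ : ∀ i j, A₁ i j + σ (A₁ j i) + σ (l₁ i) * l₁ j * f v v = 0)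
    (hA₂ : ∀ i j, A₂ i j + σ (A₂ j i) + σ (l₂ i) * l₂ j * f v v = 0) {M : GL (Fin r) K}
    (hM : A₂ * (M : Matrix (Fin r) (Fin r) K) = conjTransposeBy σ A₁) :
    projAction e M ∈ specialProjectivityGroup hΔ U := by
  obtain ⟨φ₁, hφ₁, h₁⟩ := exists_isProjectivity_three hΔ hU e hw huw huv hwv hdet₁ hA₁
  obtain ⟨φ₂, hφ₂, h₂⟩ := exists_isProjectivity_three hΔ hU e hw huw huv hwv hdet₂ hA₂
  refine ⟨3 + 3, by decide, ?_⟩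
  convert hφ₁.trans hφ₂ using 1
  ext1 T
  obtain ⟨S, rfl⟩ := exists_map_eq e T
  rw [projAction_apply, Function.comp_apply, h₁, h₂, polarMap_polarMap hΔ.involutive hdet₁ hM]

/-- Invertible Hermitian matrices act as special projectivities. -/
lemma projAction_mem_of_hermitian (hΔ : IsHermitianPolarSpace f r)
    {U : Submodule K V} (hU : IsSingular f U) (e : (Fin r → K) ≃ₗ[K] U) (H : GL (Fin r) K)
    (hH : conjTransposeBy σ (H : Matrix (Fin r) (Fin r) K) = H) :
    projAction e H ∈ specialProjectivityGroup hΔ U := by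
  obtain ⟨w, hw, huw⟩ := exists_hyperbolic_frame hΔ hU e
  obtain ⟨ε, hε, hσε⟩ := exists_ne_zero_apply_eq_neg hΔ.involutive hΔ.nontrivial
  have hH' : ∀ i j, σ ((H : Matrix (Fin r) (Fin r) K) j i) = (H : Matrix (Fin r) (Fin r) K) i j :=
    fun i j => congrFun₂ hH i j
  have hdet : ∀ M : GL (Fin r) K, ∀ c : K, c ≠ 0 →
      (c • (M : Matrix (Fin r) (Fin r) K)).det ≠ 0 := by
    intro M c hc
    rw [det_smul]
    exact mul_ne_zero (pow_ne_zero _ hc) (M.isUnit.map detMonoidHom).ne_zero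
  -- Scaling by a skew element `ε` makes `H` and `1` skew-Hermitian, and `(-ε H)^* = ε H`.
  refine projAction_mem_specialProjectivityGroup hΔ hU e hw huw (v := 0) (by simp) (by simp)
    (A₁ := (-ε) • (H : Matrix (Fin r) (Fin r) K))
    (A₂ := ε • ((1 : GL (Fin r) K) : Matrix (Fin r) (Fin r) K))
    (hdet H _ (neg_ne_zero.2 hε)) (hdet 1 _ hε) (l₁ := 0) (l₂ := 0) ?_ ?_ ?_
  · intro i j
    simp [hH', hσε]
  · intro i j
    rcases eq_or_ne i j with rfl | hij
    · simp [hσε]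
    · simp [hij, hij.symm]
  · rw [conjTransposeBy_smul, hH]
    simp [hσε]

/-- A non-trivial anisotropic part makes all matrices `diag (d, 1, …, 1)` act as special
projectivities. -/
lemma projAction_mem_of_diagonal (hΔ : IsHermitianPolarSpace f r)
    {U : Submodule K V} (hU : Maximal (IsSingular f) U) (h : ¬ HasTrivialAnisotropicPart f)
    (e : (Fin r → K) ≃ₗ[K] U) (i₀ : Fin r) (D : GL (Fin r) K) (d : K) (hd : σ d ≠ d)
    (hD : (D : Matrix (Fin r) (Fin r) K) = diagonal (Function.update 1 i₀ d)) :
    projAction e D ∈ specialProjectivityGroup hΔ U := by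
  obtain ⟨w, hw, huw⟩ := exists_hyperbolic_frame hΔ hU.1 e
  obtain ⟨v, huv, hwv, hvv⟩ := exists_anisotropic_of_not_trivial hΔ h hU e hw huw
  have hfv : σ (f v v) = f v v := hΔ.hermitian.eq v v
  have hd₁ : σ d - d ≠ 0 := sub_ne_zero.2 hd
  have hd₂ : d - σ d ≠ 0 := sub_ne_zero.2 hd.symm
  have hd₀ : d ≠ 0 := by rintro rfl; exact hd (map_zero σ)
  -- The isotropy condition at `(i₀, i₀)` for the entry `-b * σ d` reads `b * (σ d - d) = f v v`,
  -- which determines `b`; elsewhere only `σ b = -b` is needed.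
  obtain ⟨b, hb⟩ : ∃ b, b = f v v / (σ d - d) := ⟨_, rfl⟩
  have hb₀ : b ≠ 0 := hb ▸ div_ne_zero hvv hd₁
  have hσb : σ b = -b := by
    rw [hb, map_div₀, map_sub, hΔ.involutive, hfv]
    field_simp
    ring
  have hbd : b * (σ d - d) = f v v := by rw [hb, div_mul_cancel₀ _ hd₁]
  refine projAction_mem_specialProjectivityGroup hΔ hU.1 e hw huw huv hwv
    (A₁ := diagonal (Function.update (fun _ => -b) i₀ (-b * σ d)))
    (A₂ := diagonal fun _ => b) ?_ ?_ (l₁ := Pi.single i₀ 1) (l₂ := 0) ?_ ?_ ?_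
  · rw [det_diagonal, Finset.prod_ne_zero_iff]
    intro i _
    rw [Function.update_apply]
    split_ifs <;> simp [hb₀, hd₀]
  · rw [det_diagonal, Finset.prod_ne_zero_iff]
    exact fun _ _ => hb₀
  · intro i j
    rcases eq_or_ne i j with rfl | hij
    · rcases eq_or_ne i i₀ with rfl | hi
      · simp only [diagonal_apply_eq, Function.update_self, Pi.single_eq_same, map_mul, map_neg,
          map_one, hσb, hΔ.involutive]
        linear_combination -hbd
      · simp [hi, hσb]
    · rcases eq_or_ne i i₀ with rfl | hi
      · simp [hij, hij.symm]
      · simp [hij, hij.symm, hi]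
  · intro i j
    rcases eq_or_ne i j with rfl | hij
    · simp [hσb]
    · simp [hij, hij.symm]
  · rw [hD, diagonal_mul_diagonal, conjTransposeBy_diagonal]
    congr 1
    ext i
    rcases eq_or_ne i i₀ with rfl | hi
    · simp [hσb, hΔ.involutive]
    · simp [hi, hσb]

/-- Special projectivities are induced by invertible matrices. -/
lemma exists_projAction_eq (hΔ : IsHermitianPolarSpace f r)
    {U : Submodule K V} (hU : IsSingular f U) (e : (Fin r → K) ≃ₗ[K] U)
    {g : Equiv.Perm (Submodule K U)} (hg : g ∈ specialProjectivityGroup hΔ U) :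
    ∃ M : GL (Fin r) K, projAction e M = g ∧ (HasTrivialAnisotropicPart f →
      σ (M : Matrix (Fin r) (Fin r) K).det = (M : Matrix (Fin r) (Fin r) K).det) := by
  obtain ⟨n, hn, h⟩ := hg
  obtain ⟨G, hG, hGV⟩ := h.exists_linearEquiv hΔ hn
  let L : (Fin r → K) ≃ₗ[K] (Fin r → K) := (e.trans G).trans e.symm
  let M : GL (Fin r) K := GeneralLinearGroup.mkOfDetNeZero (LinearMap.toMatrix' L.toLinearMap)
    (by rw [LinearMap.det_toMatrix']; exact L.isUnit_det'.ne_zero)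
  have hML : mulVecLin (M : Matrix (Fin r) (Fin r) K) = L.toLinearMap :=
    Matrix.toLin'_toMatrix' L.toLinearMap
  have hM : ∀ s, G (e s) = e ((M : Matrix (Fin r) (Fin r) K) *ᵥ s) := by
    intro s
    have := LinearMap.congr_fun hML s
    rw [mulVecLin_apply] at this
    rw [this]
    simp [L]
  refine ⟨M, (perm_eq_projAction e fun S => ?_).symm, fun htriv => ?_⟩
  · rw [hG, matrixImage, ← Submodule.map_comp, ← Submodule.map_comp]
    congr 1
    exact LinearMap.ext hM
  · obtain ⟨w, hw, huw⟩ := exists_hyperbolic_frame hΔ hU e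
    obtain ⟨hfin, hdim⟩ := htriv.finrank_eq hΔ (fun i j => hU _ (e _).2 _ (e _).2) hw huw
    obtain ⟨T, hT, hTd, hTG⟩ := hGV hfin (by rw [hdim, ← e.finrank_eq, finrank_fin_fun])
    exact apply_det_eq_of_isometry hΔ hdim hU e hw huw hT hTd fun s => by rw [hTG, hM]

/-- The matrices acting as special projectivities form a subgroup containing the invertible
Hermitian ones; conversely, the isometry argument puts the determinant in `F`. -/
lemma range_projAction_slOver (hΔ : IsHermitianPolarSpace f r) {F : Subfield K}
    (hF : ∀ a : K, a ∈ F ↔ σ a = a) {U : Submodule K V} (hU : IsSingular f U)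
    (h : HasTrivialAnisotropicPart f) (e : (Fin r → K) ≃ₗ[K] U) :
    ((projAction e).comp (SLOver r F).subtype).range = specialProjectivityGroup hΔ U := by
  ext g
  constructor
  · rintro ⟨M, rfl⟩
    exact mem_of_hermitian_mem hΔ.involutive
      (Γ := (specialProjectivityGroup hΔ U).comap (projAction e))
      (projAction_mem_of_hermitian hΔ hU e) M ((hF _).1 M.2)
  · intro hg
    obtain ⟨M, rfl, hM⟩ := exists_projAction_eq hΔ hU e hg
    exact ⟨⟨M, (hF _).2 (hM h)⟩, rfl⟩

lemma range_projAction (hr : 1 ≤ r) (hΔ : IsHermitianPolarSpace f r) {U : Submodule K V}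
    (hU : Maximal (IsSingular f) U) (h : ¬ HasTrivialAnisotropicPart f)
    (e : (Fin r → K) ≃ₗ[K] U) : (projAction e).range = specialProjectivityGroup hΔ U := by
  ext g
  constructor
  · rintro ⟨M, rfl⟩
    exact mem_of_hermitian_mem_of_diagonal_mem hΔ.involutive
      (Γ := (specialProjectivityGroup hΔ U).comap (projAction e))
      (projAction_mem_of_hermitian hΔ hU.1 e) ⟨0, hr⟩
      (projAction_mem_of_diagonal hΔ hU h e ⟨0, hr⟩) M
  · intro hg
    obtain ⟨M, rfl, -⟩ := exists_projAction_eq hΔ hU.1 e hg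
    exact ⟨M, rfl⟩

end HermitianPolar

theorem mainTheorem6 {K V : Type*} [Field K] [AddCommGroup V] [Module K V] {σ : K →+* K}
    (f : V →ₛₗ[σ] V →ₗ[K] K) (r : ℕ) (hr : 1 ≤ r) (hΔ : IsHermitianPolarSpace f r)
    (F : Subfield K) (hF : ∀ a : K, a ∈ F ↔ σ a = a)
    (U : Submodule K V) (hU : Maximal (IsSingular f) U) :
    -- coordinates on `U`, and polarities of `U` with companion involution `σ`, exist
    Nonempty ((Fin r → K) ≃ₗ[K] U) ∧
    (∃ ρ : Equiv.Perm (Submodule K U), IsPolarity σ ρ) ∧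
    -- (i) trivial anisotropic part
    (HasTrivialAnisotropicPart f → ∀ e : (Fin r → K) ≃ₗ[K] U,
      (∃ Φ : PSLOver r F ≃* specialProjectivityGroup hΔ U,
        ∀ (M : SLOver r F) (S : Submodule K (Fin r → K)),
          (Φ (QuotientGroup.mk M) : Equiv.Perm (Submodule K U)) (S.map e.toLinearMap) =
            (matrixImage M S).map e.toLinearMap) ∧
      ∀ ρ : Equiv.Perm (Submodule K U), IsPolarity σ ρ →
        ∃ (α : Subgroup.zpowers ρ →* MulAut (PSLOver r F))
          (Ψ : PSLOver r F ⋊[α] Subgroup.zpowers ρ ≃* generalProjectivityGroup hΔ U),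
          (∀ (M : SLOver r F) (S : Submodule K (Fin r → K)),
            (Ψ (SemidirectProduct.inl (QuotientGroup.mk M)) : Equiv.Perm (Submodule K U))
              (S.map e.toLinearMap) = (matrixImage M S).map e.toLinearMap) ∧
          ∀ h : Subgroup.zpowers ρ,
            (Ψ (SemidirectProduct.inr h) : Equiv.Perm (Submodule K U)) = h) ∧
    -- (ii) non-trivial anisotropic part
    (¬ HasTrivialAnisotropicPart f → ∀ e : (Fin r → K) ≃ₗ[K] U,
      (∃ Φ : Matrix.ProjGenLinGroup (Fin r) K ≃* specialProjectivityGroup hΔ U,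
        ∀ (M : Matrix.GeneralLinearGroup (Fin r) K) (S : Submodule K (Fin r → K)),
          (Φ (Matrix.ProjGenLinGroup.mk M) : Equiv.Perm (Submodule K U)) (S.map e.toLinearMap) =
            (matrixImage M S).map e.toLinearMap) ∧
      ∀ ρ : Equiv.Perm (Submodule K U), IsPolarity σ ρ →
        ∃ (α : Subgroup.zpowers ρ →* MulAut (Matrix.ProjGenLinGroup (Fin r) K))
          (Ψ : Matrix.ProjGenLinGroup (Fin r) K ⋊[α] Subgroup.zpowers ρ ≃*
            generalProjectivityGroup hΔ U),
          (∀ (M : Matrix.GeneralLinearGroup (Fin r) K) (S : Submodule K (Fin r → K)),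
            (Ψ (SemidirectProduct.inl (Matrix.ProjGenLinGroup.mk M)) :
              Equiv.Perm (Submodule K U)) (S.map e.toLinearMap) =
                (matrixImage M S).map e.toLinearMap) ∧
          ∀ h : Subgroup.zpowers ρ,
            (Ψ (SemidirectProduct.inr h) : Equiv.Perm (Submodule K U)) = h) := by
  obtain ⟨hfin, hdim⟩ := finrank_of_maximal hΔ hU
  have e₀ : (Fin r → K) ≃ₗ[K] U :=
    LinearEquiv.ofFinrankEq _ _ (by rw [Module.finrank_fin_fun, hdim])
  refine ⟨⟨e₀⟩, exists_isPolarity e₀ hΔ.involutive, fun h e => ?_, fun h e => ?_⟩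
  · obtain ⟨Φ, hΦ⟩ := exists_quotient_mulEquiv _ (projAction_slOver_ker e F)
      (range_projAction_slOver hΔ hF hU.1 h e)
    refine ⟨⟨Φ, fun M S => ?_⟩, fun ρ hρ => ?_⟩
    · rw [hΦ]
      exact projAction_apply e M S
    · obtain ⟨α, Ψ, h₁, h₂⟩ := exists_generalProjectivityGroup_mulEquiv hr hΔ hU.1 e Φ hρ
      refine ⟨α, Ψ, fun M S => ?_, h₂⟩
      rw [h₁, hΦ]
      exact projAction_apply e M S
  · obtain ⟨Φ, hΦ⟩ : ∃ Φ : Matrix.ProjGenLinGroup (Fin r) K ≃* specialProjectivityGroup hΔ U,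
        ∀ M, (Φ (Matrix.ProjGenLinGroup.mk M) : Equiv.Perm (Submodule K U)) = projAction e M :=
      exists_quotient_mulEquiv _ (projAction_ker e) (range_projAction hr hΔ hU h e)
    refine ⟨⟨Φ, fun M S => ?_⟩, fun ρ hρ => ?_⟩
    · rw [hΦ]
      exact projAction_apply e M S
    · obtain ⟨α, Ψ, h₁, h₂⟩ := exists_generalProjectivityGroup_mulEquiv hr hΔ hU.1 e Φ hρ
      refine ⟨α, Ψ, fun M S => ?_, h₂⟩
      rw [h₁, hΦ]
      exact projAction_apply e M S
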